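/- Let $\lambda,\mu_d,t>0$, $n\ge 1$, $0<\alpha_1<\dots<\alpha_n$, let $A_1,\dots,A_n$ be non-zero reals (not necessarily positive) with $\sum_i A_i=1$, let $a>1$ and $\beta_i=\alpha_i/a$. Assume that $f_W(x)=\sum_{i=1}^n A_i\alpha_i e^{-\alpha_i x}$ is non-negative for $x>0$, so that $f_W$ and $f_{B}(x)=\sum_{i=1}^n A_i\beta_i e^{-\beta_i x}$ are probability densities on $(0,\infty)$. Let the surplus of a pool manager with initial capital $u\ge 0$ be $$R_s=u-\sum_{k=1}^{M_s}W_k+\sum_{k=1}^{N_s}B_k,\qquad s\ge 0,$$ where $(N_s)$ and $(M_s)$ are Poisson processes with intensities $\lambda$ and $\mu_d$, the $W_k$ have density $f_W$, the $B_k$ have density $f_B$, and $(N_s)$, $(M_s)$, $W_1,W_2,\dots$, $B_1,B_2,\dots$ are all independent. Let $\tau_u=\inf\{s\ge 0: R_s<0\}$, $\psi(u,s)=\mathbb P(\tau_u\le s)$, and let $\widehat\psi(u,t)=\mathbb E[\psi(u,T)]$, where $T$ is exponentially distributed with mean $t$. Consider the Lundberg equation $$\lambda\sum_{i=1}^n A_i\frac{\beta_i}{\beta_i+r}+\mu_d\sum_{i=1}^n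 A_i\frac{\alpha_i}{\alpha_i-r}-\Big(\lambda+\mu_d+\frac1t\Big)=0,\qquad r\in\mathbb C\setminus\{\alpha_1,\dots,\alpha_n,-\beta_1,\dots,-\beta_n\}.$$ Counted with multiplicity, it has exactly $n$ solutions with positive real part. If these are pairwise distinct, $r_1,\dots,r_n$ say, then $$\widehat\psi(u,t)=\sum_{k=1}^n D_k e^{-r_k u}\qquad\text{for all }u\ge 0,$$ where $$D_k=\frac{\sum_{j=1}^n\frac1{\alpha_j}\prod_{h=1}^n(\alpha_j-r_h)\prod_{i\ne j}\frac{r_k-\alpha_i}{\alpha_j-\alpha_i}}{\prod_{h\ne k}(r_k-r_h)},\qquad k=1,\dots,n,$$ and $(D_1,\dots,D_n)$ is the unique solution in $\mathbb C^n$ of the linear system $\sum_{k=1}^n\frac{D_k}{\alpha_i-r_k}=\frac1{\alpha_i}$, $i=1,\dots,n$. -/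

import Mathlib

open MeasureTheory ProbabilityTheory Set

open scoped NNReal ENNReal

noncomputable section

namespace MiningPool

variable {Ω : Type*}

/-- The density of a combination of exponentials with weights `A` and rates `α`. -/
def combExpDensity {n : ℕ} (A α : Fin n → ℝ) (x : ℝ) : ℝ :=
  ∑ i, A i * α i * Real.exp (-(α i * x))

/-- The law on `(0, ∞)` with density `combExpDensity A α` with respect to Lebesgue measure. -/
def combExpMeasure {n : ℕ} (A α : Fin n → ℝ) : Measure ℝ :=
  (volume.restrict (Ioi 0)).withDensity fun x => ENNReal.ofReal (combExpDensity A α x)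

/-- The counting process with interarrival times `ξ 0, ξ 1, …`: the number of arrivals (the `k`-th
one happening at time `ξ 0 + ⋯ + ξ k`) up to time `s`. If the `ξ k` are i.i.d. exponential with
rate `lam`, this is the homogeneous Poisson process with intensity `lam`. -/
def count (ξ : ℕ → Ω → ℝ) (s : ℝ≥0) (ω : Ω) : ℕ :=
  Set.ncard {k : ℕ | ∑ i ∈ Finset.range (k + 1), ξ i ω ≤ (s : ℝ)}

/-- The surplus of the pool manager at time `s`, started at `u`: up-jumps `B 0, B 1, …` at the
arrivals of the counting process of `ξ`, down-jumps `W 0, W 1, …` at those of `η`. -/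
def surplus (ξ η W B : ℕ → Ω → ℝ) (u : ℝ) (s : ℝ≥0) (ω : Ω) : ℝ :=
  u - ∑ k ∈ Finset.range (count η s ω), W k ω + ∑ k ∈ Finset.range (count ξ s ω), B k ω

/-- The ruin time, the infimum of all times at which the surplus is negative (`∞` if there is no
such time). -/
def ruinTime (ξ η W B : ℕ → Ω → ℝ) (u : ℝ) (ω : Ω) : ℝ≥0∞ :=
  ⨅ (s : ℝ≥0) (_ : surplus ξ η W B u s ω < 0), (s : ℝ≥0∞)

/-- The probability of ruin up to the deterministic time `s`. -/
def ruinProb [MeasurableSpace Ω] (P : Measure Ω) (ξ η W B : ℕ → Ω → ℝ) (u s : ℝ) : ℝ :=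
  P.real {ω | ruinTime ξ η W B u ω ≤ ENNReal.ofReal s}

/-- The probability of ruin up to an exponential time horizon with mean `t`, that is, the
expectation of `ruinProb P ξ η W B u T` for an exponential random variable `T` with mean `t`. -/
def ruinProbExp [MeasurableSpace Ω] (P : Measure Ω) (ξ η W B : ℕ → Ω → ℝ) (u t : ℝ) : ℝ :=
  ∫ s, ruinProb P ξ η W B u s ∂(expMeasure (1 / t))

/-- The ingredients of the surplus process: interarrival times `ξ` of the up-jumps (exponential
with rate `lam`), interarrival times `η` of the down-jumps (exponential with rate `mud`), sizes `W`
of the down-jumps (with law `lawW`) and sizes `B` of the up-jumps (with law `lawB`). All of these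
random variables are mutually independent. -/
structure IsPoolModel [MeasurableSpace Ω] (P : Measure Ω) (lam mud : ℝ) (lawW lawB : Measure ℝ)
    (ξ η W B : ℕ → Ω → ℝ) : Prop where
  measurable_up : ∀ k, Measurable (ξ k)
  measurable_down : ∀ k, Measurable (η k)
  measurable_W : ∀ k, Measurable (W k)
  measurable_B : ∀ k, Measurable (B k)
  law_up : ∀ k, P.map (ξ k) = expMeasure lam
  law_down : ∀ k, P.map (η k) = expMeasure mud
  law_W : ∀ k, P.map (W k) = lawW
  law_B : ∀ k, P.map (B k) = lawB
  indep : iIndepFun (fun p : Fin 4 × ℕ => ![ξ, η, W, B] p.1 p.2) P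

/-- The left-hand side of the generalized Lundberg equation. -/
def lundberg {n : ℕ} (A α β : Fin n → ℝ) (lam mud t : ℝ) (r : ℂ) : ℂ :=
  lam * ∑ i, (A i : ℂ) * (β i / (β i + r)) + mud * ∑ i, (A i : ℂ) * (α i / (α i - r))
    - (lam + mud + 1 / t)

/-- The solutions with positive real part of the Lundberg equation. The poles `α i` are excluded,
the equation being meaningless there (the other poles `-β i` are negative). -/
def lundbergRoots {n : ℕ} (A α β : Fin n → ℝ) (lam mud t : ℝ) : Set ℂ :=
  {r | 0 < r.re ∧ (∀ i, r ≠ α i) ∧ lundberg A α β lam mud t r = 0}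

/-- The explicit coefficients of the ruin probability. -/
def ruinCoeff {n : ℕ} (α : Fin n → ℝ) (r : Fin n → ℂ) (k : Fin n) : ℂ :=
  (∑ j, 1 / (α j : ℂ) * (∏ h, ((α j : ℂ) - r h)) *
      ∏ i ∈ Finset.univ.erase j, (r k - α i) / ((α j : ℂ) - α i)) /
    ∏ h ∈ Finset.univ.erase k, (r k - r h)

end MiningPool

end

/-! Put `q = 1 / t`. By Tonelli, the probability of ruin before an exponential time of rate `q` is
the expectation of `exp (-q τ)`, where `τ` is the ruin time. Conditioning on the first jump suggests
the equation `(lam + mud + q) g(u) = lam E g(u + B) + mud E g(u - W)` for `u ≥ 0`, with `g = 1` on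
the negative half-line. Because `lam + mud < lam + mud + q`, this is a fixed-point equation of a
contraction for the supremum norm and has at most one bounded measurable solution.

The equation is never derived for the ruin probability itself. The ruin time is bracketed, path by
path, between approximations that follow `m` events and then declare the remaining time to be `0` or
`⊤` (`ruinApprox_zero_le`, `le_ruinApprox_top`). Their discounted expectations satisfy the equation
as a recursion in `m` (`approxRuin_succ`), by lack of memory of the exponential clocks, and hence
approach any bounded solution geometrically (`norm_approxRuin_sub_le`). Squeezing identifies the
ruin probability with that solution (`IsPoolModel.ruinProbExp_eq`).

A solution is found by inserting `∑ D_k exp (-r_k u)`: the terms in `exp (-r_k u)` cancel because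
`r_k` solves the Lundberg equation, those in `exp (-α_i u)` because `D` solves the linear system
(`expComb_eq_integral`). That system says which values the numerator of the rational function `∑ D_k
/ (z - r_k)` takes at the `α_i`, so Lagrange interpolation solves it uniquely (`linear_system_iff`).

For the number of roots, the Lundberg equation is cleared of denominators and its jump terms are
scaled by `c ∈ [0, 1]`. On the imaginary axis these terms have modulus at most `lam + mud`, so no
root crosses it, and at `c = 0` the roots are the `α_i` and the `-β_i` (`lundbergRoots_count`). -/

namespace MiningPool

/-! ### Deterministic paths: arrival times, surplus and ruin time. -/

/-- Removal of the first term of a sequence. -/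
def seqTail (x : ℕ → ℝ) : ℕ → ℝ := fun k => x (k + 1)

/-- Insertion of a new first term into a sequence. -/
def seqCons (a : ℝ) (x : ℕ → ℝ) : ℕ → ℝ
  | 0 => a
  | k + 1 => x k

@[simp] theorem seqCons_zero (a : ℝ) (x : ℕ → ℝ) : seqCons a x 0 = a := rfl

@[simp] theorem seqCons_succ (a : ℝ) (x : ℕ → ℝ) (k : ℕ) : seqCons a x (k + 1) = x k := rfl

@[simp] theorem seqTail_apply (x : ℕ → ℝ) (k : ℕ) : seqTail x k = x (k + 1) := rfl

@[simp] theorem seqTail_seqCons (a : ℝ) (x : ℕ → ℝ) : seqTail (seqCons a x) = x := rfl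

/-- The time of the `k`-th arrival if `x` is the sequence of interarrival times. -/
def arrival (x : ℕ → ℝ) (k : ℕ) : ℝ := ∑ i ∈ Finset.range (k + 1), x i

theorem arrival_zero (x : ℕ → ℝ) : arrival x 0 = x 0 := by simp [arrival]

theorem arrival_succ (x : ℕ → ℝ) (k : ℕ) : arrival x (k + 1) = x 0 + arrival (seqTail x) k := by
  rw [arrival, Finset.sum_range_succ', add_comm]; rfl

theorem arrival_seqCons_sub (x : ℕ → ℝ) (d : ℝ) (k : ℕ) :
    arrival (seqCons (x 0 - d) (seqTail x)) k = arrival x k - d := by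
  rcases k with _ | k
  · simp [arrival_zero]
  · rw [arrival_succ, arrival_succ, seqTail_seqCons, seqCons_zero]; ring

theorem le_arrival {x : ℕ → ℝ} (hx : ∀ k, 0 < x k) (k : ℕ) : x 0 ≤ arrival x k :=
  Finset.single_le_sum (f := x) (fun i _ => (hx i).le) (Finset.mem_range.2 k.succ_pos)

/-- Pairs of sequences of interarrival times for which the two counting processes are locally finite
and never jump at the same time. -/
structure GoodPath (x y : ℕ → ℝ) : Prop where
  pos_left : ∀ k, 0 < x k
  pos_right : ∀ k, 0 < y k
  finite_left : ∀ s : ℝ, {k | arrival x k ≤ s}.Finite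
  finite_right : ∀ s : ℝ, {k | arrival y k ≤ s}.Finite
  ne : ∀ j k, arrival x j ≠ arrival y k

theorem GoodPath.symm {x y : ℕ → ℝ} (h : GoodPath x y) : GoodPath y x :=
  ⟨h.2, h.1, h.4, h.3, fun j k => (h.5 k j).symm⟩

/-- Restarting at the first arrival `x 0` uses up that clock and leaves the other with residual
waiting time `y 0 - x 0`; all arrival times are merely shifted by `x 0`. -/
theorem GoodPath.step {x y : ℕ → ℝ} (h : GoodPath x y) (hxy : x 0 < y 0) :
    GoodPath (seqTail x) (seqCons (y 0 - x 0) (seqTail y)) where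
  pos_left k := h.pos_left (k + 1)
  pos_right k := by
    rcases k with _ | k
    · exact sub_pos.2 hxy
    · exact h.pos_right (k + 1)
  finite_left s := by
    refine ((h.finite_left (s + x 0)).preimage (f := Nat.succ) Nat.succ_injective.injOn).subset ?_
    intro k hk
    have hk' : arrival (seqTail x) k ≤ s := hk
    change arrival x (k + 1) ≤ s + x 0
    rw [arrival_succ]; linarith
  finite_right s := by
    refine (h.finite_right (s + x 0)).subset fun k hk => ?_
    have hk' : arrival (seqCons (y 0 - x 0) (seqTail y)) k ≤ s := hk
    rw [arrival_seqCons_sub] at hk'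
    change arrival y k ≤ s + x 0
    linarith
  ne j k := by
    rw [arrival_seqCons_sub]
    have := h.ne (j + 1) k
    rw [arrival_succ] at this
    intro e
    exact this (by linarith)

/-- The number of arrivals up to time `s`. -/
noncomputable def arrivalCount (x : ℕ → ℝ) (s : ℝ) : ℕ := Set.ncard {k | arrival x k ≤ s}

theorem arrivalCount_of_lt {x : ℕ → ℝ} (hx : ∀ k, 0 < x k) {s : ℝ} (hs : s < x 0) :
    arrivalCount x s = 0 := by
  have : {k | arrival x k ≤ s} = ∅ := by
    refine Set.eq_empty_of_forall_notMem fun k hk => ?_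
    have hk' : arrival x k ≤ s := hk
    linarith [le_arrival hx k]
  rw [arrivalCount, this, Set.ncard_empty]

/-- Finiteness matters: `Set.ncard` is `0` on infinite sets, where the count would not increase by
one. -/
theorem arrivalCount_add {x : ℕ → ℝ} (hfin : ∀ s : ℝ, {k | arrival (seqTail x) k ≤ s}.Finite) {s : ℝ}
    (hs : 0 ≤ s) : arrivalCount x (x 0 + s) = arrivalCount (seqTail x) s + 1 := by
  have : {k | arrival x k ≤ x 0 + s} = insert 0 (Nat.succ '' {k | arrival (seqTail x) k ≤ s}) := by
    ext k
    rcases k with _ | k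
    · simp [arrival_zero, hs]
    · simp [arrival_succ]
  rw [arrivalCount, this, Set.ncard_insert_of_notMem (by simp) ((hfin s).image _),
    Set.ncard_image_of_injective _ Nat.succ_injective, arrivalCount]

theorem arrivalCount_seqCons_sub (x : ℕ → ℝ) (d s : ℝ) :
    arrivalCount (seqCons (x 0 - d) (seqTail x)) s = arrivalCount x (d + s) := by
  unfold arrivalCount
  congr 1
  ext k
  simp only [mem_ofPred_eq, arrival_seqCons_sub]
  constructor <;> intro h <;> linarith

/-- The surplus along a single path. -/
noncomputable def pathSurplus (w b x y : ℕ → ℝ) (u s : ℝ) : ℝ :=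
  u - ∑ k ∈ Finset.range (arrivalCount y s), w k + ∑ k ∈ Finset.range (arrivalCount x s), b k

/-- The ruin time along a single path. -/
noncomputable def pathRuinTime (w b x y : ℕ → ℝ) (u : ℝ) : ℝ≥0∞ :=
  ⨅ (s : ℝ≥0) (_ : pathSurplus w b x y u s < 0), (s : ℝ≥0∞)

/-- Restart principle for first passage: nothing happens before `d`, and from `d` on `f` is a copy
of `g`. -/
theorem iInf_neg_eq_add {f g : ℝ≥0 → ℝ} (d : ℝ≥0) (hf : ∀ s < d, 0 ≤ f s)
    (hfg : ∀ s, f (d + s) = g s) :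
    ⨅ (s : ℝ≥0) (_ : f s < 0), (s : ℝ≥0∞) = d + ⨅ (s : ℝ≥0) (_ : g s < 0), (s : ℝ≥0∞) := by
  apply le_antisymm
  · simp only [ENNReal.add_iInf]
    refine le_iInf₂ fun s hs => ?_
    refine (iInf₂_le (d + s) (by rwa [hfg])).trans ?_
    simp
  · refine le_iInf₂ fun s hs => ?_
    have hds : d ≤ s := not_lt.1 fun h => (hf s h).not_gt hs
    obtain ⟨e, rfl⟩ := exists_add_of_le hds
    rw [ENNReal.coe_add]
    gcongr
    exact iInf₂_le e (by rwa [← hfg])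

theorem pathRuinTime_of_neg {w b x y : ℕ → ℝ} (h : GoodPath x y) {u : ℝ} (hu : u < 0) :
    pathRuinTime w b x y u = 0 := by
  refine le_antisymm ?_ bot_le
  refine (iInf₂_le (0 : ℝ≥0) ?_).trans (by simp)
  simp [pathSurplus, arrivalCount_of_lt h.pos_left (h.pos_left 0),
    arrivalCount_of_lt h.pos_right (h.pos_right 0), hu]

theorem pathRuinTime_of_lt {w b x y : ℕ → ℝ} (h : GoodPath x y) {u : ℝ} (hu : 0 ≤ u)
    (hxy : x 0 < y 0) :
    pathRuinTime w b x y u = ENNReal.ofReal (x 0) +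
      pathRuinTime w (seqTail b) (seqTail x) (seqCons (y 0 - x 0) (seqTail y)) (u + b 0) := by
  refine iInf_neg_eq_add (x 0).toNNReal (fun s hs => ?_) fun s => ?_
  · have hs' : (s : ℝ) < x 0 := Real.lt_toNNReal_iff_coe_lt.1 hs
    simp [pathSurplus, arrivalCount_of_lt h.pos_left hs',
      arrivalCount_of_lt h.pos_right (hs'.trans hxy), hu]
  · rw [NNReal.coe_add, Real.coe_toNNReal _ (h.pos_left 0).le, pathSurplus, pathSurplus,
      arrivalCount_seqCons_sub, arrivalCount_add (h.step hxy).finite_left s.coe_nonneg,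
      Finset.sum_range_succ']
    simp only [seqTail_apply]
    ring

theorem pathRuinTime_of_gt {w b x y : ℕ → ℝ} (h : GoodPath x y) {u : ℝ} (hu : 0 ≤ u)
    (hxy : y 0 < x 0) :
    pathRuinTime w b x y u = ENNReal.ofReal (y 0) +
      pathRuinTime (seqTail w) b (seqCons (x 0 - y 0) (seqTail x)) (seqTail y) (u - w 0) := by
  refine iInf_neg_eq_add (y 0).toNNReal (fun s hs => ?_) fun s => ?_
  · have hs' : (s : ℝ) < y 0 := Real.lt_toNNReal_iff_coe_lt.1 hs
    simp [pathSurplus, arrivalCount_of_lt h.pos_right hs',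
      arrivalCount_of_lt h.pos_left (hs'.trans hxy), hu]
  · rw [NNReal.coe_add, Real.coe_toNNReal _ (h.pos_right 0).le, pathSurplus, pathSurplus,
      arrivalCount_seqCons_sub, arrivalCount_add (h.symm.step hxy).finite_left s.coe_nonneg,
      Finset.sum_range_succ']
    simp only [seqTail_apply]
    ring

/-! ### Approximations of the ruin time by finitely many events. -/

/-- The space of the paths: down-jumps, up-jumps, interarrival times of the up-jumps, interarrival
times of the down-jumps. -/
abbrev PathSpace : Type := (ℕ → ℝ) × (ℕ → ℝ) × (ℕ → ℝ) × (ℕ → ℝ)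

open Classical in
/-- Approximation of the ruin time on the basis of the first `m` events; the remaining time to ruin
after these events is replaced by `v`. -/
noncomputable def ruinApprox (v : ℝ≥0∞) : ℕ → ℝ × PathSpace → ℝ≥0∞
  | 0, (u, _) => if u < 0 then 0 else v
  | m + 1, (u, w, b, x, y) =>
    if u < 0 then 0
    else if x 0 < y 0 then
      ENNReal.ofReal (x 0) +
        ruinApprox v m (u + b 0, w, seqTail b, seqTail x, seqCons (y 0 - x 0) (seqTail y))
    else if y 0 < x 0 then
      ENNReal.ofReal (y 0) +
        ruinApprox v m (u - w 0, seqTail w, b, seqCons (x 0 - y 0) (seqTail x), seqTail y)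
    else ⊤

theorem ruinApprox_zero_le (m : ℕ) (u : ℝ) (w b x y : ℕ → ℝ) (h : GoodPath x y) :
    ruinApprox 0 m (u, w, b, x, y) ≤ pathRuinTime w b x y u := by
  induction m generalizing u w b x y with
  | zero => simp [ruinApprox]
  | succ m ih =>
    rw [ruinApprox]
    split_ifs with hu h1 h2
    · exact bot_le
    · rw [pathRuinTime_of_lt h (not_lt.1 hu) h1]
      gcongr
      exact ih _ _ _ _ _ (h.step h1)
    · rw [pathRuinTime_of_gt h (not_lt.1 hu) h2]
      gcongr
      exact ih _ _ _ _ _ (h.symm.step h2).symm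
    -- A tie of the two first arrivals is ruled out on a good path.
    · exact absurd (le_antisymm (not_lt.1 h2) (not_lt.1 h1))
        (by simpa [arrival_zero] using h.ne 0 0)

theorem le_ruinApprox_top (m : ℕ) (u : ℝ) (w b x y : ℕ → ℝ) (h : GoodPath x y) :
    pathRuinTime w b x y u ≤ ruinApprox ⊤ m (u, w, b, x, y) := by
  induction m generalizing u w b x y with
  | zero =>
    rw [ruinApprox]
    split_ifs with hu
    · rw [pathRuinTime_of_neg h hu]
    · exact le_top
  | succ m ih =>
    rw [ruinApprox]
    split_ifs with hu h1 h2
    · rw [pathRuinTime_of_neg h hu]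
    · rw [pathRuinTime_of_lt h (not_lt.1 hu) h1]
      gcongr
      exact ih _ _ _ _ _ (h.step h1)
    · rw [pathRuinTime_of_gt h (not_lt.1 hu) h2]
      gcongr
      exact ih _ _ _ _ _ (h.symm.step h2).symm
    · exact le_top

theorem measurable_seqTail : Measurable seqTail :=
  measurable_pi_lambda _ fun k => measurable_pi_apply (k + 1)

theorem measurable_seqCons : Measurable fun p : ℝ × (ℕ → ℝ) => seqCons p.1 p.2 := by
  refine measurable_pi_lambda _ fun k => ?_
  rcases k with _ | k
  · exact measurable_fst
  · exact (measurable_pi_apply k).comp measurable_snd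

theorem Measurable.seqTail {γ : Type*} [MeasurableSpace γ] {f : γ → ℕ → ℝ} (hf : Measurable f) :
    Measurable fun c => seqTail (f c) := measurable_seqTail.comp hf

theorem Measurable.seqCons {γ : Type*} [MeasurableSpace γ] {a : γ → ℝ} {f : γ → ℕ → ℝ}
    (ha : Measurable a) (hf : Measurable f) : Measurable fun c => seqCons (a c) (f c) :=
  measurable_seqCons.comp (ha.prodMk hf)

theorem measurable_ruinApprox (v : ℝ≥0∞) (m : ℕ) : Measurable (ruinApprox v m) := by
  induction m with
  | zero =>
    exact Measurable.ite (measurableSet_lt measurable_fst measurable_const) measurable_const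
      measurable_const
  | succ m ih =>
    have hw : Measurable fun p : ℝ × PathSpace => p.2.1 := by fun_prop
    have hb : Measurable fun p : ℝ × PathSpace => p.2.2.1 := by fun_prop
    have hx : Measurable fun p : ℝ × PathSpace => p.2.2.2.1 := by fun_prop
    have hy : Measurable fun p : ℝ × PathSpace => p.2.2.2.2 := by fun_prop
    have hw0 : Measurable fun p : ℝ × PathSpace => p.2.1 0 := by fun_prop
    have hb0 : Measurable fun p : ℝ × PathSpace => p.2.2.1 0 := by fun_prop
    have hx0 : Measurable fun p : ℝ × PathSpace => p.2.2.2.1 0 := by fun_prop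
    have hy0 : Measurable fun p : ℝ × PathSpace => p.2.2.2.2 0 := by fun_prop
    refine Measurable.ite (measurableSet_lt measurable_fst measurable_const) measurable_const ?_
    refine Measurable.ite (measurableSet_lt hx0 hy0) ?_ ?_
    · refine hx0.ennreal_ofReal.add (ih.comp ?_)
      exact (measurable_fst.add hb0).prodMk (hw.prodMk ((Measurable.seqTail hb).prodMk
        ((Measurable.seqTail hx).prodMk (Measurable.seqCons (hy0.sub hx0) (Measurable.seqTail hy)))))
    refine Measurable.ite (measurableSet_lt hy0 hx0) ?_ measurable_const
    · refine hy0.ennreal_ofReal.add (ih.comp ?_)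
      exact (measurable_fst.sub hw0).prodMk ((Measurable.seqTail hw).prodMk (hb.prodMk
        ((Measurable.seqCons (hx0.sub hy0) (Measurable.seqTail hx)).prodMk (Measurable.seqTail hy))))

/-! ### Independent sequences and competing exponential clocks. -/

/-- The law of an i.i.d. sequence. -/
noncomputable abbrev iidMeasure (ρ : Measure ℝ) [IsProbabilityMeasure ρ] : Measure (ℕ → ℝ) :=
  Measure.infinitePi fun _ : ℕ => ρ

/-- Compared on cylinder sets, which determine an infinite product measure. This is what lets the
first coordinate be integrated separately. -/
theorem map_seqCons_iidMeasure (ρ : Measure ℝ) [IsProbabilityMeasure ρ] :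
    (ρ.prod (iidMeasure ρ)).map (fun p => seqCons p.1 p.2) = iidMeasure ρ := by
  classical
  refine Measure.eq_infinitePi _ fun s t ht => ?_
  set s' : Finset ℕ := s.preimage Nat.succ Nat.succ_injective.injOn with hs'
  have hpre : (fun p : ℝ × (ℕ → ℝ) => seqCons p.1 p.2) ⁻¹' (Set.pi s t) =
      (if 0 ∈ s then t 0 else univ) ×ˢ Set.pi s' (fun k => t (k + 1)) := by
    ext ⟨a, x⟩
    simp only [mem_preimage, Set.mem_pi, mem_prod, Finset.mem_coe, hs', Finset.mem_preimage]
    constructor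
    · intro h
      refine ⟨?_, fun k hk => h (k + 1) hk⟩
      split_ifs with h0
      · exact h 0 h0
      · trivial
    · rintro ⟨h0, h⟩ k hk
      rcases k with _ | k
      · simpa [hk] using h0
      · exact h k hk
  rw [Measure.map_apply measurable_seqCons (MeasurableSet.pi s.countable_toSet fun i _ => ht i),
    hpre, Measure.prod_prod, Measure.infinitePi_pi _ fun k _ => ht (k + 1)]
  have hmap : ∏ k ∈ s', ρ (t (k + 1)) = ∏ k ∈ s.erase 0, ρ (t k) := by
    refine (Finset.prod_map s' ⟨Nat.succ, Nat.succ_injective⟩ fun k => ρ (t k)).symm.trans ?_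
    congr 1
    ext k
    rcases k with _ | k <;> simp [hs']
  rw [hmap]
  split_ifs with h0
  · exact Finset.mul_prod_erase s (fun k => ρ (t k)) h0
  · rw [measure_univ, one_mul, Finset.erase_eq_of_notMem h0]

theorem lintegral_iidMeasure (ρ : Measure ℝ) [IsProbabilityMeasure ρ] {F : (ℕ → ℝ) → ℝ≥0∞}
    (hF : Measurable F) :
    ∫⁻ x, F x ∂(iidMeasure ρ) = ∫⁻ a, ∫⁻ x, F (seqCons a x) ∂(iidMeasure ρ) ∂ρ := by
  conv_lhs => rw [← map_seqCons_iidMeasure ρ]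
  rw [lintegral_map hF measurable_seqCons]
  exact lintegral_prod _ (hF.comp measurable_seqCons).aemeasurable

theorem expMeasure_eq_withDensity (r : ℝ) :
    expMeasure r = (volume.restrict (Ioi 0)).withDensity
      fun x => ENNReal.ofReal (r * Real.exp (-(r * x))) := by
  have h : (exponentialPDF r) =ᵐ[volume]
      (Ioi (0 : ℝ)).indicator fun x => ENNReal.ofReal (r * Real.exp (-(r * x))) := by
    filter_upwards [Measure.ae_ne volume (0 : ℝ)] with x hx
    rcases lt_or_gt_of_ne hx with h | h
    · rw [exponentialPDF_of_neg h, indicator_of_notMem (by simpa using h.le)]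
    · rw [exponentialPDF_of_nonneg h.le, indicator_of_mem (by simpa using h)]
  rw [← withDensity_indicator measurableSet_Ioi]
  exact withDensity_congr_ae h

theorem lintegral_expMeasure (r : ℝ) (F : ℝ → ℝ≥0∞) :
    ∫⁻ x, F x ∂(expMeasure r) =
      ∫⁻ x in Ioi 0, ENNReal.ofReal (r * Real.exp (-(r * x))) * F x := by
  rw [expMeasure_eq_withDensity, lintegral_withDensity_eq_lintegral_mul_non_measurable]
  · rfl
  · fun_prop
  · exact ae_of_all _ fun x => ENNReal.ofReal_lt_top

theorem ae_pos_expMeasure (r : ℝ) : ∀ᵐ x ∂(expMeasure r), 0 < x := by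
  rw [expMeasure_eq_withDensity]
  exact (withDensity_absolutelyContinuous _ _).ae_le (ae_restrict_mem measurableSet_Ioi)

instance noAtoms_expMeasure (r : ℝ) : NullSingletonClass (expMeasure r) := by
  rw [expMeasure_eq_withDensity]
  infer_instance

theorem lintegral_exp_neg_expMeasure {r q : ℝ} (hr : 0 < r) (hq : 0 ≤ q) :
    ∫⁻ x, ENNReal.ofReal (Real.exp (-(q * x))) ∂(expMeasure r) = ENNReal.ofReal (r / (r + q)) := by
  have hrq : 0 < r + q := by positivity
  have := isProbabilityMeasure_expMeasure hrq
  have h1 : ∫⁻ _, 1 ∂(expMeasure (r + q)) = 1 := by simp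
  rw [lintegral_expMeasure] at h1 ⊢
  calc ∫⁻ x in Ioi 0, ENNReal.ofReal (r * Real.exp (-(r * x))) * ENNReal.ofReal (Real.exp (-(q * x)))
      = ∫⁻ x in Ioi 0, ENNReal.ofReal (r / (r + q)) *
          (ENNReal.ofReal ((r + q) * Real.exp (-((r + q) * x))) * 1) := by
        refine lintegral_congr fun x => ?_
        rw [mul_one, ← ENNReal.ofReal_mul (by positivity), ← ENNReal.ofReal_mul (by positivity),
          show -((r + q) * x) = -(r * x) + -(q * x) by ring, Real.exp_add]
        congr 1
        field_simp
    _ = ENNReal.ofReal (r / (r + q)) := by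
        rw [lintegral_const_mul' _ _ ENNReal.ofReal_ne_top, h1, mul_one]

/-- The lack of memory of the exponential distribution, in integrated form. -/
theorem lintegral_shift_expMeasure (r : ℝ) {a : ℝ} (ha : 0 ≤ a) (H : ℝ → ℝ≥0∞) :
    ∫⁻ b, (if a < b then H (b - a) else 0) ∂(expMeasure r) =
      ENNReal.ofReal (Real.exp (-(r * a))) * ∫⁻ b, H b ∂(expMeasure r) := by
  rw [lintegral_expMeasure, lintegral_expMeasure,
    ← lintegral_const_mul' _ _ ENNReal.ofReal_ne_top, ← lintegral_indicator measurableSet_Ioi,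
    ← lintegral_indicator measurableSet_Ioi,
    ← lintegral_add_right_eq_self _ a]
  refine lintegral_congr fun x => ?_
  by_cases hx : 0 < x
  · rw [indicator_of_mem (show x + a ∈ Ioi 0 by simp; linarith), indicator_of_mem (by simpa using hx),
      if_pos (by linarith), add_sub_cancel_right, ← mul_assoc,
      ← ENNReal.ofReal_mul (by positivity)]
    congr 2
    rw [mul_add, neg_add, Real.exp_add]
    ring
  · rw [indicator_of_notMem (show x ∉ Ioi 0 by simpa using hx)]
    by_cases hxa : 0 < x + a
    · rw [indicator_of_mem (by simpa using hxa), if_neg (by linarith), mul_zero]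
    · rw [indicator_of_notMem (by simpa using hxa)]

/-- The other clock survives until `a` with probability `exp (-r' a)` and is then as good as new. So
survival and discounting together contribute `exp (-(r' + q) a)`, whose mean under rate `r` is `r /
(r + r' + q)`. -/
theorem lintegral_first_clock {r r' q : ℝ} (hr : 0 < r) (hr' : 0 < r') (hq : 0 ≤ q) (H : ℝ → ℝ≥0∞) :
    ∫⁻ a, ∫⁻ b, (if a < b then ENNReal.ofReal (Real.exp (-(q * a))) * H (b - a) else 0)
        ∂(expMeasure r') ∂(expMeasure r) =
      ENNReal.ofReal (r / (r + r' + q)) * ∫⁻ b, H b ∂(expMeasure r') := by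
  have h : ∀ᵐ a ∂(expMeasure r),
      ∫⁻ b, (if a < b then ENNReal.ofReal (Real.exp (-(q * a))) * H (b - a) else 0)
        ∂(expMeasure r') =
      ENNReal.ofReal (Real.exp (-((r' + q) * a))) * ∫⁻ b, H b ∂(expMeasure r') := by
    filter_upwards [ae_pos_expMeasure r] with a ha
    rw [lintegral_shift_expMeasure r' ha.le
      fun z => ENNReal.ofReal (Real.exp (-(q * a))) * H z,
      lintegral_const_mul' _ _ ENNReal.ofReal_ne_top, ← mul_assoc,
      ← ENNReal.ofReal_mul (by positivity), ← Real.exp_add]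
    congr 3
    ring_nf
  rw [lintegral_congr_ae h, lintegral_mul_const _ (by fun_prop),
    lintegral_exp_neg_expMeasure hr (by positivity), add_assoc]

/-- The regeneration property behind the renewal recursion: on the event that the first clock wins,
the restarted pair of clocks again has the original law, independently of the elapsed time. -/
theorem lintegral_first_event {r r' q : ℝ} (hr : 0 < r) (hr' : 0 < r') (hq : 0 ≤ q)
    [IsProbabilityMeasure (expMeasure r)] [IsProbabilityMeasure (expMeasure r')]
    {K : (ℕ → ℝ) × (ℕ → ℝ) → ℝ≥0∞} (hK : Measurable K) :
    ∫⁻ p, (if p.1 0 < p.2 0 then ENNReal.ofReal (Real.exp (-(q * p.1 0))) *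
          K (seqTail p.1, seqCons (p.2 0 - p.1 0) (seqTail p.2)) else 0)
        ∂((iidMeasure (expMeasure r)).prod (iidMeasure (expMeasure r'))) =
      ENNReal.ofReal (r / (r + r' + q)) *
        ∫⁻ p, K p ∂((iidMeasure (expMeasure r)).prod (iidMeasure (expMeasure r'))) := by
  have hmeas : Measurable fun p : (ℕ → ℝ) × (ℕ → ℝ) =>
      if p.1 0 < p.2 0 then ENNReal.ofReal (Real.exp (-(q * p.1 0))) *
          K (seqTail p.1, seqCons (p.2 0 - p.1 0) (seqTail p.2)) else 0 := by
    refine Measurable.ite (measurableSet_lt (by fun_prop) (by fun_prop)) ?_ measurable_const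
    refine Measurable.mul (by fun_prop) (hK.comp ?_)
    exact (Measurable.seqTail measurable_fst).prodMk
      (Measurable.seqCons (by fun_prop) (Measurable.seqTail measurable_snd))
  set ν := iidMeasure (expMeasure r)
  set ν' := iidMeasure (expMeasure r')
  have hKc : Measurable fun p : (ℝ × (ℕ → ℝ)) × (ℕ → ℝ) => K (p.1.2, seqCons p.1.1 p.2) :=
    hK.comp ((measurable_snd.comp measurable_fst).prodMk
      (Measurable.seqCons (measurable_fst.comp measurable_fst) measurable_snd))
  have hKm : Measurable fun p : ℝ × (ℕ → ℝ) => ∫⁻ y, K (p.2, seqCons p.1 y) ∂ν' :=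
    hKc.lintegral_prod_right'
  -- All variables but the residual time `z` of the losing clock are integrated out, which reduces
  -- the claim to two exponential variables.
  set H : ℝ → ℝ≥0∞ := fun z => ∫⁻ x, ∫⁻ y, K (x, seqCons z y) ∂ν' ∂ν with hH
  have hRHS : ∫⁻ p, K p ∂(ν.prod ν') = ∫⁻ z, H z ∂(expMeasure r') := by
    rw [lintegral_prod _ hK.aemeasurable]
    have : ∀ x, ∫⁻ y, K (x, y) ∂ν' = ∫⁻ z, ∫⁻ y, K (x, seqCons z y) ∂ν' ∂(expMeasure r') :=
      fun x => lintegral_iidMeasure _ (hK.comp measurable_prodMk_left)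
    rw [lintegral_congr this]
    exact lintegral_lintegral_swap (hKm.comp measurable_swap).aemeasurable
  rw [hRHS, ← lintegral_first_clock hr hr' hq, lintegral_prod _ hmeas.aemeasurable,
    lintegral_iidMeasure _ hmeas.lintegral_prod_right']
  refine lintegral_congr fun a => ?_
  have h1 : ∀ x, ∫⁻ y, (if seqCons a x 0 < y 0 then ENNReal.ofReal (Real.exp (-(q * seqCons a x 0))) *
          K (seqTail (seqCons a x), seqCons (y 0 - seqCons a x 0) (seqTail y)) else 0) ∂ν' =
      ∫⁻ b, (if a < b then ENNReal.ofReal (Real.exp (-(q * a))) *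
        ∫⁻ y, K (x, seqCons (b - a) y) ∂ν' else 0) ∂(expMeasure r') := by
    intro x
    refine (lintegral_iidMeasure _
      (hmeas.comp (measurable_prodMk_left (x := seqCons a x)))).trans (lintegral_congr fun b => ?_)
    by_cases hab : a < b
    · rw [if_pos hab]
      exact (lintegral_congr fun y => if_pos hab).trans
        (lintegral_const_mul' (ENNReal.ofReal (Real.exp (-(q * a))))
          (fun y => K (x, seqCons (b - a) y)) ENNReal.ofReal_ne_top)
    · rw [if_neg hab]
      exact (lintegral_congr fun y => if_neg hab).trans lintegral_zero
  rw [lintegral_congr h1]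
  rw [lintegral_lintegral_swap]
  · refine lintegral_congr fun b => ?_
    split_ifs
    · rw [lintegral_const_mul' _ _ ENNReal.ofReal_ne_top]
    · simp
  · refine Measurable.aemeasurable ?_
    refine Measurable.ite (measurableSet_lt measurable_const measurable_snd) ?_ measurable_const
    exact Measurable.const_mul (hKm.comp ((measurable_snd.sub_const a).prodMk measurable_fst)) _

theorem lintegral_first_event' {r r' q : ℝ} (hr : 0 < r) (hr' : 0 < r') (hq : 0 ≤ q)
    [IsProbabilityMeasure (expMeasure r)] [IsProbabilityMeasure (expMeasure r')]
    {K : (ℕ → ℝ) × (ℕ → ℝ) → ℝ≥0∞} (hK : Measurable K) :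
    ∫⁻ p, (if p.2 0 < p.1 0 then ENNReal.ofReal (Real.exp (-(q * p.2 0))) *
          K (seqCons (p.1 0 - p.2 0) (seqTail p.1), seqTail p.2) else 0)
        ∂((iidMeasure (expMeasure r)).prod (iidMeasure (expMeasure r'))) =
      ENNReal.ofReal (r' / (r + r' + q)) *
        ∫⁻ p, K p ∂((iidMeasure (expMeasure r)).prod (iidMeasure (expMeasure r'))) := by
  have h := lintegral_first_event hr' hr hq (hK.comp measurable_swap)
  rw [add_comm r r']
  rw [← lintegral_prod_swap, ← lintegral_prod_swap K]
  exact h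

/-! ### Discounting and the exponential horizon. -/

/-- The discounted value of `1` at time `τ` under the discount rate `q`. -/
noncomputable def discount (q : ℝ) (τ : ℝ≥0∞) : ℝ≥0∞ :=
  if τ = ⊤ then 0 else ENNReal.ofReal (Real.exp (-(q * τ.toReal)))

theorem measurable_discount (q : ℝ) : Measurable (discount q) := by
  refine Measurable.ite (measurableSet_singleton _) measurable_const ?_
  fun_prop

theorem discount_zero (q : ℝ) : discount q 0 = 1 := by simp [discount]

theorem discount_top (q : ℝ) : discount q ⊤ = 0 := by simp [discount]

theorem discount_le_one {q : ℝ} (hq : 0 ≤ q) (τ : ℝ≥0∞) : discount q τ ≤ 1 := by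
  unfold discount
  split_ifs
  · exact zero_le_one
  · rw [ENNReal.ofReal_le_one, Real.exp_le_one_iff, neg_nonpos]
    positivity

theorem discount_ofReal_add (q : ℝ) {x : ℝ} (hx : 0 ≤ x) (τ : ℝ≥0∞) :
    discount q (ENNReal.ofReal x + τ) = ENNReal.ofReal (Real.exp (-(q * x))) * discount q τ := by
  unfold discount
  by_cases h : τ = ⊤
  · simp [h]
  · rw [if_neg h, if_neg (by simp [h]), ENNReal.toReal_add ENNReal.ofReal_ne_top h,
      ENNReal.toReal_ofReal hx, ← ENNReal.ofReal_mul (by positivity), ← Real.exp_add]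
    congr 2
    ring

theorem expMeasure_setOf_le {q : ℝ} (hq : 0 < q) (τ : ℝ≥0∞) :
    expMeasure q {s | τ ≤ ENNReal.ofReal s} = discount q τ := by
  unfold discount
  split_ifs with h
  · simp [h]
  · lift τ to ℝ≥0 using h
    have := isProbabilityMeasure_expMeasure hq
    -- With `H = 1`, lack of memory is the tail formula for `τ < s`; the boundary `s = τ` is a null
    -- set.
    have h1 := lintegral_shift_expMeasure q τ.2 fun _ => 1
    simp only [lintegral_one, measure_univ, mul_one] at h1
    rw [ENNReal.coe_toReal]
    refine Eq.trans ?_ h1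
    rw [← lintegral_indicator_one
      (measurableSet_le measurable_const ENNReal.measurable_ofReal)]
    refine lintegral_congr_ae ?_
    filter_upwards [ae_pos_expMeasure q, Measure.ae_ne (expMeasure q) (τ : ℝ)] with s hs hne
    have : s ∈ {s | (τ : ℝ≥0∞) ≤ ENNReal.ofReal s} ↔ (τ : ℝ) < s := by
      rw [mem_ofPred_eq, ← ENNReal.ofReal_coe_nnreal, ENNReal.ofReal_le_ofReal_iff hs.le]
      exact ⟨fun h => lt_of_le_of_ne h hne.symm, le_of_lt⟩
    simp only [indicator, this, Pi.one_apply]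
    rfl

/-! ### The law of the path of the model. -/

/-- The law of the paths with independent i.i.d. components. -/
noncomputable abbrev pathMeasure (lawW lawB lawX lawY : Measure ℝ) [IsProbabilityMeasure lawW]
    [IsProbabilityMeasure lawB] [IsProbabilityMeasure lawX] [IsProbabilityMeasure lawY] :
    Measure PathSpace :=
  (iidMeasure lawW).prod ((iidMeasure lawB).prod ((iidMeasure lawX).prod (iidMeasure lawY)))

/-- The components of a path as a single family, in the order used by `IsPoolModel`. -/
def pathFamily (z : PathSpace) (p : Fin 4 × ℕ) : ℝ :=
  (![z.2.2.1, z.2.2.2, z.1, z.2.1] : Fin 4 → ℕ → ℝ) p.1 p.2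

theorem measurable_pathFamily : Measurable pathFamily := by
  refine measurable_pi_lambda _ fun p => ?_
  obtain ⟨i, k⟩ := p
  fin_cases i <;> simp [pathFamily] <;> fun_prop

/-- Independence in the model concerns one family indexed by `Fin 4 × ℕ`, whereas the recursion
integrates over a nested product of four sequence spaces; this identifies the two laws. -/
theorem map_pathMeasure (law : Fin 4 → Measure ℝ) [∀ i, IsProbabilityMeasure (law i)] :
    (pathMeasure (law 2) (law 3) (law 0) (law 1)).map pathFamily =
    Measure.infinitePi fun p : Fin 4 × ℕ => law p.1 := by
  classical
  refine Measure.eq_infinitePi _ fun s t ht => ?_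
  set S : Fin 4 → Finset ℕ := fun i => s.preimage (Prod.mk i) (Prod.mk_right_injective i).injOn
    with hS
  have hpre : pathFamily ⁻¹' (Set.pi s t) = (Set.pi (S 2) fun k => t (2, k)) ×ˢ ((Set.pi (S 3) fun k => t (3, k)) ×ˢ
        ((Set.pi (S 0) fun k => t (0, k)) ×ˢ (Set.pi (S 1) fun k => t (1, k)))) := by
    ext ⟨w, b, x, y⟩
    simp only [mem_preimage, Set.mem_pi, mem_prod, Finset.mem_coe, hS, Finset.mem_preimage,
      Prod.forall, Fin.forall_fin_succ]
    simp [pathFamily]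
    tauto
  rw [Measure.map_apply measurable_pathFamily (MeasurableSet.pi s.countable_toSet fun i _ => ht i), hpre,
    Measure.prod_prod, Measure.prod_prod, Measure.prod_prod,
    Measure.infinitePi_pi _ fun k _ => ht _, Measure.infinitePi_pi _ fun k _ => ht _,
    Measure.infinitePi_pi _ fun k _ => ht _, Measure.infinitePi_pi _ fun k _ => ht _,
    Finset.prod_finset_product s Finset.univ S (fun p => by simp [hS]), Fin.prod_univ_four]
  ring

/-- The path of the pool model. -/
def poolPath {Ω : Type*} (ξ η W B : ℕ → Ω → ℝ) (ω : Ω) : PathSpace :=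
  (fun k => W k ω, fun k => B k ω, fun k => ξ k ω, fun k => η k ω)

section Model

variable {Ω : Type*} [MeasurableSpace Ω] {P : Measure Ω} {lam mud : ℝ} {lawW lawB : Measure ℝ}
  {ξ η W B : ℕ → Ω → ℝ}

theorem IsPoolModel.measurable_poolPath (h : IsPoolModel P lam mud lawW lawB ξ η W B) :
    Measurable (poolPath ξ η W B) :=
  (measurable_pi_lambda _ h.measurable_W).prodMk ((measurable_pi_lambda _ h.measurable_B).prodMk
    ((measurable_pi_lambda _ h.measurable_up).prodMk (measurable_pi_lambda _ h.measurable_down)))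

theorem IsPoolModel.map_poolPath (h : IsPoolModel P lam mud lawW lawB ξ η W B)
    [IsProbabilityMeasure lawW] [IsProbabilityMeasure lawB]
    [IsProbabilityMeasure (expMeasure lam)] [IsProbabilityMeasure (expMeasure mud)] :
    P.map (poolPath ξ η W B) = pathMeasure lawW lawB (expMeasure lam) (expMeasure mud) := by
  set law : Fin 4 → Measure ℝ := ![expMeasure lam, expMeasure mud, lawW, lawB] with hlaw
  have hprob : ∀ i, IsProbabilityMeasure (law i) := by
    intro i
    fin_cases i <;> simp [hlaw] <;> infer_instance
  have hm : ∀ p : Fin 4 × ℕ, Measurable (![ξ, η, W, B] p.1 p.2) := by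
    rintro ⟨i, k⟩
    fin_cases i
    · exact h.measurable_up k
    · exact h.measurable_down k
    · exact h.measurable_W k
    · exact h.measurable_B k
  have h1 := h.indep.map_fun_eq_infinitePi_map hm
  have h2 : (fun p : Fin 4 × ℕ => P.map (![ξ, η, W, B] p.1 p.2)) = fun p => law p.1 := by
    funext ⟨i, k⟩
    fin_cases i
    · exact h.law_up k
    · exact h.law_down k
    · exact h.law_W k
    · exact h.law_B k
  rw [h2, ← map_pathMeasure law] at h1
  set ψ : (Fin 4 × ℕ → ℝ) → PathSpace := fun f =>
    (fun k => f (2, k), fun k => f (3, k), fun k => f (0, k), fun k => f (1, k)) with hψ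
  have hψm : Measurable ψ := by fun_prop
  have h3 := congrArg (Measure.map ψ) h1
  rw [Measure.map_map hψm (measurable_pi_lambda _ hm), Measure.map_map hψm measurable_pathFamily] at h3
  refine h3.trans ?_
  -- `ψ` undoes `pathFamily` definitionally.
  exact Measure.map_id

end Model

/-! ### Almost every path is good. -/

theorem measurable_arrival (k : ℕ) : Measurable fun x : ℕ → ℝ => arrival x k := by
  unfold arrival
  fun_prop

/-- With all later coordinates fixed, the arrival time is the first coordinate plus a constant, and
`ρ` has no atoms. -/
theorem iidMeasure_arrival_eq (ρ : Measure ℝ) [IsProbabilityMeasure ρ] [NullSingletonClass ρ] (k : ℕ) (c : ℝ) :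
    iidMeasure ρ {x | arrival x k = c} = 0 := by
  have hs : MeasurableSet {x | arrival x k = c} := measurable_arrival k (measurableSet_singleton c)
  rw [← map_seqCons_iidMeasure, Measure.map_apply measurable_seqCons hs, ← Measure.prod_swap,
    Measure.map_apply measurable_swap (measurable_seqCons hs), Measure.measure_prod_null
      (measurable_swap (measurable_seqCons hs))]
  refine ae_of_all _ fun x => ?_
  have h : ∀ a, arrival (seqCons a x) k = a + arrival (seqCons 0 x) k := fun a => by
    rcases k with _ | k
    · simp [arrival_zero]
    · simp [arrival_succ]
  have : Prod.mk x ⁻¹' (Prod.swap ⁻¹' ((fun p : ℝ × (ℕ → ℝ) => seqCons p.1 p.2) ⁻¹'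
      {x | arrival x k = c})) = {c - arrival (seqCons 0 x) k} := by
    ext a
    simp only [mem_preimage, Prod.swap_prod_mk, mem_ofPred_eq, mem_singleton_iff, h a]
    constructor <;> intro e <;> linarith
  exact (congrArg ρ this).trans (measure_singleton _)

theorem lintegral_exp_neg_arrival {r : ℝ} (hr : 0 < r) [IsProbabilityMeasure (expMeasure r)] (k : ℕ) :
    ∫⁻ x, ENNReal.ofReal (Real.exp (-arrival x k)) ∂(iidMeasure (expMeasure r)) =
      ENNReal.ofReal (r / (r + 1)) ^ (k + 1) := by
  have h1 : ∫⁻ a, ENNReal.ofReal (Real.exp (-a)) ∂(expMeasure r) = ENNReal.ofReal (r / (r + 1)) := by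
    simpa using lintegral_exp_neg_expMeasure hr zero_le_one
  have hm : ∀ k, Measurable fun x : ℕ → ℝ => ENNReal.ofReal (Real.exp (-arrival x k)) := fun k =>
    (Real.measurable_exp.comp (measurable_arrival k).neg).ennreal_ofReal
  induction k with
  | zero =>
    rw [lintegral_iidMeasure _ (hm 0)]
    simpa [arrival_zero] using h1
  | succ k ih =>
    rw [lintegral_iidMeasure _ (hm _)]
    have : ∀ a x, ENNReal.ofReal (Real.exp (-arrival (seqCons a x) (k + 1))) =
        ENNReal.ofReal (Real.exp (-a)) * ENNReal.ofReal (Real.exp (-arrival x k)) := fun a x => by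
      rw [arrival_succ, seqCons_zero, seqTail_seqCons, neg_add, Real.exp_add,
        ENNReal.ofReal_mul (by positivity)]
    simp only [this]
    simp only [lintegral_const_mul' _ _ ENNReal.ofReal_ne_top, ih]
    rw [lintegral_mul_const _ (by fun_prop), h1, pow_succ' _ (k + 1)]

theorem ae_pos_iidMeasure (r : ℝ) [IsProbabilityMeasure (expMeasure r)] :
    ∀ᵐ x ∂(iidMeasure (expMeasure r)), ∀ k, 0 < x k :=
  ae_all_iff.2 fun k =>
    (measurePreserving_eval_infinitePi (fun _ : ℕ => expMeasure r) k).quasiMeasurePreserving.ae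
      (ae_pos_expMeasure r)

theorem ae_finite_arrival {r : ℝ} (hr : 0 < r) [IsProbabilityMeasure (expMeasure r)] :
    ∀ᵐ x ∂(iidMeasure (expMeasure r)), ∀ s : ℝ, {k | arrival x k ≤ s}.Finite := by
  have hnull : ∀ N : ℕ, iidMeasure (expMeasure r) {x | ∀ k, arrival x k ≤ N} = 0 := by
    intro N
    have hc : ENNReal.ofReal (r / (r + 1)) < 1 := by
      rw [ENNReal.ofReal_lt_one, div_lt_one (by positivity)]
      linarith
    have hlim : Filter.Tendsto (fun k : ℕ => ENNReal.ofReal (r / (r + 1)) ^ (k + 1)) Filter.atTop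
        (nhds 0) :=
      (ENNReal.tendsto_pow_atTop_nhds_zero_of_lt_one hc).comp (Filter.tendsto_add_atTop_nat 1)
    -- Markov's inequality for `exp (-arrival x k)`, whose expectation decays geometrically in `k`.
    have hle : ∀ k : ℕ, ENNReal.ofReal (Real.exp (-(N : ℝ))) *
        iidMeasure (expMeasure r) {x | ∀ k, arrival x k ≤ N} ≤
          ENNReal.ofReal (r / (r + 1)) ^ (k + 1) := by
      intro k
      rw [← lintegral_exp_neg_arrival hr k]
      refine le_trans ?_ (mul_meas_ge_le_lintegral
        (Real.measurable_exp.comp (measurable_arrival k).neg).ennreal_ofReal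
        (ENNReal.ofReal (Real.exp (-(N : ℝ)))))
      gcongr
      intro hk
      exact ENNReal.ofReal_le_ofReal (Real.exp_le_exp.2 (neg_le_neg (hk k)))
    have h0 := le_antisymm (ge_of_tendsto' hlim hle) bot_le
    refine (mul_eq_zero.1 h0).resolve_left ?_
    exact (ENNReal.ofReal_pos.2 (Real.exp_pos _)).ne'
  have h1 : ∀ᵐ x ∂(iidMeasure (expMeasure r)), ∀ N : ℕ, ¬ ∀ k, arrival x k ≤ N := by
    refine ae_all_iff.2 fun N => ?_
    rw [ae_iff]
    simpa using hnull N
  filter_upwards [ae_pos_iidMeasure r, h1] with x hpos hx s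
  obtain ⟨N, hN⟩ := exists_nat_ge s
  obtain ⟨k, hk⟩ := not_forall.1 (hx N)
  refine (finite_lt_nat k).subset fun j hj => ?_
  have hj' : arrival x j ≤ s := hj
  by_contra hkj
  have hmono : arrival x k ≤ arrival x j :=
    Finset.sum_le_sum_of_subset_of_nonneg
      (Finset.range_subset_range.2 (Nat.succ_le_succ (not_lt.1 hkj))) fun i _ _ => (hpos i).le
  exact hk (hmono.trans (hj'.trans hN))

theorem ae_goodPath {r r' : ℝ} (hr : 0 < r) (hr' : 0 < r') [IsProbabilityMeasure (expMeasure r)]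
    [IsProbabilityMeasure (expMeasure r')] :
    ∀ᵐ p ∂((iidMeasure (expMeasure r)).prod (iidMeasure (expMeasure r'))), GoodPath p.1 p.2 := by
  have hne : ∀ᵐ p ∂((iidMeasure (expMeasure r)).prod (iidMeasure (expMeasure r'))),
      ∀ j k, arrival p.1 j ≠ arrival p.2 k := by
    refine ae_all_iff.2 fun j => ae_all_iff.2 fun k => ?_
    have hs : MeasurableSet {p : (ℕ → ℝ) × (ℕ → ℝ) | arrival p.1 j = arrival p.2 k} :=
      measurableSet_eq_fun ((measurable_arrival j).comp measurable_fst)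
        ((measurable_arrival k).comp measurable_snd)
    rw [ae_iff]
    simp only [not_not, ne_eq]
    rw [Measure.measure_prod_null hs]
    refine ae_of_all _ fun x => ?_
    simp only [preimage_ofPred_eq, eq_comm (a := arrival x j)]
    exact iidMeasure_arrival_eq (expMeasure r') k (arrival x j)
  filter_upwards [hne, Measure.quasiMeasurePreserving_fst.ae (ae_pos_iidMeasure r),
    Measure.quasiMeasurePreserving_snd.ae (ae_pos_iidMeasure r'),
    Measure.quasiMeasurePreserving_fst.ae (ae_finite_arrival hr),
    Measure.quasiMeasurePreserving_snd.ae (ae_finite_arrival hr')] with p h h1 h2 h3 h4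
  exact ⟨h1, h2, h3, h4, h⟩

/-! ### The renewal recursion for the approximations. -/

section Renewal

/-- Separates the next jump size from the remaining randomness, whose law is unchanged. -/
theorem lintegral_iidMeasure_prod {Γ : Type*} [MeasurableSpace Γ] (ρ : Measure ℝ)
    [IsProbabilityMeasure ρ] (μ : Measure Γ) [SFinite μ] {F : ℝ × (ℕ → ℝ) × Γ → ℝ≥0∞}
    (hF : Measurable F) :
    ∫⁻ p, F (p.1 0, seqTail p.1, p.2) ∂((iidMeasure ρ).prod μ) =
      ∫⁻ a, ∫⁻ p, F (a, p) ∂((iidMeasure ρ).prod μ) ∂ρ := by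
  have h1 : Measurable fun p : (ℕ → ℝ) × Γ => F (p.1 0, seqTail p.1, p.2) :=
    hF.comp (Measurable.prodMk (by fun_prop)
      ((Measurable.seqTail measurable_fst).prodMk measurable_snd))
  rw [lintegral_prod _ h1.aemeasurable, lintegral_iidMeasure _ h1.lintegral_prod_right']
  refine lintegral_congr fun a => ?_
  exact (lintegral_prod _ (hF.comp measurable_prodMk_left).aemeasurable).symm

variable {lawW lawB : Measure ℝ} {lam mud q : ℝ} [IsProbabilityMeasure lawW]
  [IsProbabilityMeasure lawB] [IsProbabilityMeasure (expMeasure lam)]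
  [IsProbabilityMeasure (expMeasure mud)]

theorem measurable_first_up {K : PathSpace → ℝ≥0∞} (hK : Measurable K) (q : ℝ) :
    Measurable fun z : PathSpace => if z.2.2.1 0 < z.2.2.2 0 then
      ENNReal.ofReal (Real.exp (-(q * z.2.2.1 0))) * K (z.1, z.2.1, seqTail z.2.2.1,
        seqCons (z.2.2.2 0 - z.2.2.1 0) (seqTail z.2.2.2)) else 0 := by
  refine Measurable.ite (measurableSet_lt (by fun_prop) (by fun_prop)) ?_ measurable_const
  refine Measurable.mul (by fun_prop) (hK.comp ?_)
  exact measurable_fst.prodMk ((measurable_fst.comp measurable_snd).prodMk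
    ((Measurable.seqTail (by fun_prop)).prodMk
      (Measurable.seqCons (by fun_prop) (Measurable.seqTail (by fun_prop)))))

theorem measurable_first_down {K : PathSpace → ℝ≥0∞} (hK : Measurable K) (q : ℝ) :
    Measurable fun z : PathSpace => if z.2.2.2 0 < z.2.2.1 0 then
      ENNReal.ofReal (Real.exp (-(q * z.2.2.2 0))) * K (z.1, z.2.1,
        seqCons (z.2.2.1 0 - z.2.2.2 0) (seqTail z.2.2.1), seqTail z.2.2.2) else 0 := by
  refine Measurable.ite (measurableSet_lt (by fun_prop) (by fun_prop)) ?_ measurable_const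
  refine Measurable.mul (by fun_prop) (hK.comp ?_)
  exact measurable_fst.prodMk ((measurable_fst.comp measurable_snd).prodMk
    ((Measurable.seqCons (by fun_prop) (Measurable.seqTail (by fun_prop))).prodMk
      (Measurable.seqTail (by fun_prop))))

theorem lintegral_pathMeasure {F : PathSpace → ℝ≥0∞} (hF : Measurable F) :
    ∫⁻ z, F z ∂(pathMeasure lawW lawB (expMeasure lam) (expMeasure mud)) =
      ∫⁻ w, ∫⁻ b, ∫⁻ p, F (w, b, p) ∂((iidMeasure (expMeasure lam)).prod (iidMeasure (expMeasure mud)))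
        ∂(iidMeasure lawB) ∂(iidMeasure lawW) := by
  rw [lintegral_prod _ hF.aemeasurable]
  exact lintegral_congr fun w => lintegral_prod _ (hF.comp measurable_prodMk_left).aemeasurable

theorem lintegral_first_up (hlam : 0 < lam) (hmud : 0 < mud) (hq : 0 ≤ q) {K : PathSpace → ℝ≥0∞}
    (hK : Measurable K) :
    ∫⁻ z, (if z.2.2.1 0 < z.2.2.2 0 then
      ENNReal.ofReal (Real.exp (-(q * z.2.2.1 0))) * K (z.1, z.2.1, seqTail z.2.2.1,
        seqCons (z.2.2.2 0 - z.2.2.1 0) (seqTail z.2.2.2)) else 0)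
        ∂(pathMeasure lawW lawB (expMeasure lam) (expMeasure mud)) =
      ENNReal.ofReal (lam / (lam + mud + q)) *
        ∫⁻ z, K z ∂(pathMeasure lawW lawB (expMeasure lam) (expMeasure mud)) := by
  rw [lintegral_pathMeasure (measurable_first_up hK q), lintegral_pathMeasure hK]
  simp only [← lintegral_const_mul' _ _ (ENNReal.ofReal_ne_top (r := lam / (lam + mud + q)))]
  refine lintegral_congr fun w => lintegral_congr fun b => ?_
  rw [lintegral_const_mul' _ _ ENNReal.ofReal_ne_top]
  exact lintegral_first_event hlam hmud hq (K := fun p => K (w, b, p))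
    (hK.comp (measurable_prodMk_left.comp measurable_prodMk_left))

theorem lintegral_first_down (hlam : 0 < lam) (hmud : 0 < mud) (hq : 0 ≤ q) {K : PathSpace → ℝ≥0∞}
    (hK : Measurable K) :
    ∫⁻ z, (if z.2.2.2 0 < z.2.2.1 0 then
      ENNReal.ofReal (Real.exp (-(q * z.2.2.2 0))) * K (z.1, z.2.1,
        seqCons (z.2.2.1 0 - z.2.2.2 0) (seqTail z.2.2.1), seqTail z.2.2.2) else 0)
        ∂(pathMeasure lawW lawB (expMeasure lam) (expMeasure mud)) =
      ENNReal.ofReal (mud / (lam + mud + q)) *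
        ∫⁻ z, K z ∂(pathMeasure lawW lawB (expMeasure lam) (expMeasure mud)) := by
  rw [lintegral_pathMeasure (measurable_first_down hK q), lintegral_pathMeasure hK]
  simp only [← lintegral_const_mul' _ _ (ENNReal.ofReal_ne_top (r := mud / (lam + mud + q)))]
  refine lintegral_congr fun w => lintegral_congr fun b => ?_
  rw [lintegral_const_mul' _ _ ENNReal.ofReal_ne_top]
  exact lintegral_first_event' hlam hmud hq (K := fun p => K (w, b, p))
    (hK.comp (measurable_prodMk_left.comp measurable_prodMk_left))

variable (lawW lawB lam mud q) in
/-- The expected discounted value of `1` at the `m`-th approximation of the ruin time. -/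
noncomputable def approxRuin (v : ℝ≥0∞) (m : ℕ) (u : ℝ) : ℝ≥0∞ :=
  ∫⁻ z, discount q (ruinApprox v m (u, z))
    ∂(pathMeasure lawW lawB (expMeasure lam) (expMeasure mud))

theorem measurable_discount_ruinApprox (q : ℝ) (v : ℝ≥0∞) (m : ℕ) :
    Measurable fun z : ℝ × PathSpace => discount q (ruinApprox v m z) :=
  (measurable_discount q).comp (measurable_ruinApprox v m)

theorem measurable_approxRuin (v : ℝ≥0∞) (m : ℕ) :
    Measurable (approxRuin lawW lawB lam mud q v m) :=
  (measurable_discount_ruinApprox q v m).lintegral_prod_right'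

theorem approxRuin_le_one (hq : 0 ≤ q) (v : ℝ≥0∞) (m : ℕ) (u : ℝ) :
    approxRuin lawW lawB lam mud q v m u ≤ 1 :=
  (lintegral_mono fun _ => discount_le_one hq _).trans (by simp)

theorem approxRuin_of_neg (v : ℝ≥0∞) (m : ℕ) {u : ℝ} (hu : u < 0) :
    approxRuin lawW lawB lam mud q v m u = 1 := by
  have : ∀ z : PathSpace, ruinApprox v m (u, z) = 0 := fun z => by
    rcases m with _ | m <;> simp [ruinApprox, hu]
  simp [approxRuin, this, discount_zero]

/-- Discounting turns the waiting time added by `ruinApprox` into a factor, the clocks regenerate at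
the first event, and the jump made there is independent of what follows. -/
theorem approxRuin_succ (hlam : 0 < lam) (hmud : 0 < mud) (hq : 0 ≤ q) (v : ℝ≥0∞) (m : ℕ) {u : ℝ}
    (hu : 0 ≤ u) :
    approxRuin lawW lawB lam mud q v (m + 1) u =
      ENNReal.ofReal (lam / (lam + mud + q)) *
          ∫⁻ a, approxRuin lawW lawB lam mud q v m (u + a) ∂lawB +
        ENNReal.ofReal (mud / (lam + mud + q)) *
          ∫⁻ a, approxRuin lawW lawB lam mud q v m (u - a) ∂lawW := by
  set G : ℝ × PathSpace → ℝ≥0∞ := fun z => discount q (ruinApprox v m z) with hG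
  have hGm : Measurable G := measurable_discount_ruinApprox q v m
  set K₁ : PathSpace → ℝ≥0∞ := fun z => G (u + z.2.1 0, z.1, seqTail z.2.1, z.2.2) with hK₁
  set K₂ : PathSpace → ℝ≥0∞ := fun z => G (u - z.1 0, seqTail z.1, z.2.1, z.2.2) with hK₂
  have hK₁m : Measurable K₁ := hGm.comp (Measurable.prodMk (by fun_prop)
    (measurable_fst.prodMk ((Measurable.seqTail (by fun_prop)).prodMk (by fun_prop))))
  have hK₂m : Measurable K₂ := hGm.comp (Measurable.prodMk (by fun_prop)
    ((Measurable.seqTail (by fun_prop)).prodMk (Measurable.prodMk (by fun_prop) (by fun_prop))))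
  have hae : ∀ᵐ z ∂(pathMeasure lawW lawB (expMeasure lam) (expMeasure mud)),
      GoodPath z.2.2.1 z.2.2.2 :=
    (Measure.quasiMeasurePreserving_snd.comp Measure.quasiMeasurePreserving_snd).ae
      (ae_goodPath hlam hmud)
  have hsplit : approxRuin lawW lawB lam mud q v (m + 1) u =
      ∫⁻ z, ((if z.2.2.1 0 < z.2.2.2 0 then
        ENNReal.ofReal (Real.exp (-(q * z.2.2.1 0))) * K₁ (z.1, z.2.1, seqTail z.2.2.1,
          seqCons (z.2.2.2 0 - z.2.2.1 0) (seqTail z.2.2.2)) else 0) +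
        (if z.2.2.2 0 < z.2.2.1 0 then
      ENNReal.ofReal (Real.exp (-(q * z.2.2.2 0))) * K₂ (z.1, z.2.1,
        seqCons (z.2.2.1 0 - z.2.2.2 0) (seqTail z.2.2.1), seqTail z.2.2.2) else 0))
        ∂(pathMeasure lawW lawB (expMeasure lam) (expMeasure mud)) := by
    refine lintegral_congr_ae ?_
    filter_upwards [hae] with z hz
    obtain ⟨w, b, x, y⟩ := z
    rw [ruinApprox, if_neg hu.not_gt]
    rcases lt_trichotomy (x 0) (y 0) with h | h | h
    · simp only [if_pos h, if_neg h.not_gt, add_zero, hK₁, hG]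
      rw [discount_ofReal_add q (hz.pos_left 0).le]
    -- At a tie `ruinApprox` is `⊤`, which is discounted to `0`, just as both conditionals vanish.
    · simp [h, discount_top]
    · simp only [if_pos h, if_neg h.not_gt, zero_add, hK₂, hG]
      rw [discount_ofReal_add q (hz.pos_right 0).le]
  rw [hsplit, lintegral_add_left (measurable_first_up hK₁m q),
    lintegral_first_up hlam hmud hq hK₁m, lintegral_first_down hlam hmud hq hK₂m]
  congr 2
  · have hF : Measurable fun z : (ℝ × (ℕ → ℝ)) × ((ℕ → ℝ) × (ℕ → ℝ) × (ℕ → ℝ)) =>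
        G (u + z.1.1, z.1.2, z.2) :=
      hGm.comp (Measurable.prodMk (by fun_prop) (by fun_prop))
    rw [lintegral_prod _ hK₁m.aemeasurable]
    have : ∀ w, ∫⁻ p, K₁ (w, p)
        ∂((iidMeasure lawB).prod ((iidMeasure (expMeasure lam)).prod (iidMeasure (expMeasure mud)))) =
        ∫⁻ a, ∫⁻ p, G (u + a, w, p) ∂((iidMeasure lawB).prod
          ((iidMeasure (expMeasure lam)).prod (iidMeasure (expMeasure mud)))) ∂lawB := fun w =>
      lintegral_iidMeasure_prod lawB _ (F := fun z => G (u + z.1, w, z.2))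
        (hGm.comp (Measurable.prodMk (by fun_prop) (by fun_prop)))
    rw [lintegral_congr this, lintegral_lintegral_swap]
    · refine lintegral_congr fun a => ?_
      exact (lintegral_prod _ (hGm.comp measurable_prodMk_left).aemeasurable).symm
    · exact (hF.lintegral_prod_right'.comp measurable_swap).aemeasurable
  · exact lintegral_iidMeasure_prod lawW _ (F := fun z => G (u - z.1, z.2))
      (hGm.comp (Measurable.prodMk (by fun_prop) (by fun_prop)))

end Renewal

/-! ### Combinations of exponentials: Laplace transforms and the integral equation. -/

theorem measurable_combExpDensity {n : ℕ} (A α : Fin n → ℝ) : Measurable (combExpDensity A α) := by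
  unfold combExpDensity
  fun_prop

/-- An up-jump is distributed like `a` times a down-jump, so non-negativity passes from one density
to the other. -/
theorem combExpDensity_div {n : ℕ} {A α β : Fin n → ℝ} {a : ℝ} (hβ : ∀ i, β i = α i / a) (x : ℝ) :
    combExpDensity A β x = combExpDensity A α (x / a) / a := by
  unfold combExpDensity
  rw [Finset.sum_div]
  refine Finset.sum_congr rfl fun i _ => ?_
  rw [hβ, show α i / a * x = α i * (x / a) by ring]
  ring

theorem integral_combExpMeasure {n : ℕ} {A α : Fin n → ℝ}
    (hdens : ∀ x : ℝ, 0 < x → 0 ≤ combExpDensity A α x) (f : ℝ → ℂ) :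
    ∫ x, f x ∂(combExpMeasure A α) = ∫ x in Ioi (0 : ℝ), (combExpDensity A α x : ℂ) * f x := by
  rw [combExpMeasure, integral_withDensity_eq_integral_toReal_smul
    (measurable_combExpDensity A α).ennreal_ofReal (ae_of_all _ fun x => ENNReal.ofReal_lt_top)]
  refine setIntegral_congr_fun measurableSet_Ioi fun x hx => ?_
  simp only [ENNReal.toReal_ofReal (hdens x hx), Complex.real_smul]

theorem combExpDensity_mul_exp {n : ℕ} (A α : Fin n → ℝ) (s : ℂ) (x : ℝ) :
    (combExpDensity A α x : ℂ) * Complex.exp (-(s * x)) =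
      ∑ i, (A i : ℂ) * α i * Complex.exp (-(α i + s) * x) := by
  rw [combExpDensity]
  push_cast
  rw [Finset.sum_mul]
  refine Finset.sum_congr rfl fun i _ => ?_
  rw [mul_assoc, ← Complex.exp_add]
  congr 2
  ring

theorem integrableOn_combExpDensity_mul_exp {n : ℕ} {A α : Fin n → ℝ} {s : ℂ}
    (hs : ∀ i, 0 < α i + s.re) (c : ℝ) :
    IntegrableOn (fun x : ℝ => (combExpDensity A α x : ℂ) * Complex.exp (-(s * x))) (Ioi c) := by
  simp only [combExpDensity_mul_exp]
  refine integrable_finsetSum _ fun i _ => Integrable.const_mul ?_ _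
  exact integrableOn_exp_mul_complex_Ioi (by have := hs i; simp; linarith) c

theorem integral_Ioi_combExpDensity_mul_exp {n : ℕ} {A α : Fin n → ℝ} {s : ℂ}
    (hs : ∀ i, 0 < α i + s.re) (c : ℝ) :
    ∫ x in Ioi c, (combExpDensity A α x : ℂ) * Complex.exp (-(s * x)) =
      ∑ i, (A i : ℂ) * α i / (α i + s) * Complex.exp (-(α i + s) * c) := by
  have hre : ∀ i, (-((α i : ℂ) + s)).re < 0 := fun i => by have := hs i; simp; linarith
  simp only [combExpDensity_mul_exp]
  rw [integral_finsetSum _ fun i _ =>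
    Integrable.const_mul (integrableOn_exp_mul_complex_Ioi (hre i) c) _]
  refine Finset.sum_congr rfl fun i _ => ?_
  rw [integral_const_mul, integral_exp_mul_complex_Ioi (hre i), neg_div_neg_eq]
  ring

theorem integral_Ioc_combExpDensity_mul_exp {n : ℕ} {A α : Fin n → ℝ} {s : ℂ}
    (hs : ∀ i, (α i : ℂ) + s ≠ 0) {c : ℝ} (hc : 0 ≤ c) :
    ∫ x in Ioc 0 c, (combExpDensity A α x : ℂ) * Complex.exp (-(s * x)) =
      ∑ i, (A i : ℂ) * α i / (α i + s) * (1 - Complex.exp (-(α i + s) * c)) := by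
  simp only [combExpDensity_mul_exp]
  rw [← intervalIntegral.integral_of_le hc, intervalIntegral.integral_finsetSum fun i _ => by
    apply Continuous.intervalIntegrable; fun_prop]
  refine Finset.sum_congr rfl fun i _ => ?_
  rw [intervalIntegral.integral_const_mul, integral_exp_mul_complex (neg_ne_zero.2 (hs i))]
  have := hs i
  have h2 : -(s + α i) ≠ 0 := by rw [add_comm]; exact neg_ne_zero.2 this
  simp only [Complex.ofReal_zero, mul_zero, Complex.exp_zero, div_neg]
  ring

/-- The Laplace transform of a combination of exponentials. -/
theorem integral_exp_combExpMeasure {n : ℕ} {A α : Fin n → ℝ}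
    (hdens : ∀ x : ℝ, 0 < x → 0 ≤ combExpDensity A α x) {s : ℂ} (hs : ∀ i, 0 < α i + s.re) :
    ∫ x : ℝ, Complex.exp (-(s * x)) ∂(combExpMeasure A α) = ∑ i, (A i : ℂ) * α i / (α i + s) := by
  rw [integral_combExpMeasure hdens, integral_Ioi_combExpDensity_mul_exp hs]
  simp

theorem combExpMeasure_Iic {n : ℕ} (A α : Fin n → ℝ) : combExpMeasure A α (Iic 0) = 0 := by
  rw [combExpMeasure, withDensity_apply _ measurableSet_Iic,
    Measure.restrict_restrict measurableSet_Iic, Iic_inter_Ioi]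
  simp

theorem ae_pos_combExpMeasure {n : ℕ} (A α : Fin n → ℝ) : ∀ᵐ x ∂(combExpMeasure A α), 0 < x := by
  rw [ae_iff]
  simpa [Iic] using combExpMeasure_Iic A α

theorem norm_exp_neg_mul_le {s : ℂ} (hs : 0 ≤ s.re) {x : ℝ} (hx : 0 ≤ x) :
    ‖Complex.exp (-(s * x))‖ ≤ 1 := by
  rw [Complex.norm_exp, Real.exp_le_one_iff]
  simpa using mul_nonneg hs hx

/-- The sum is the expectation of a function of modulus at most `1`. A termwise estimate would fail,
since the weights may be negative. -/
theorem norm_laplace_le_one {n : ℕ} {A α : Fin n → ℝ} [IsProbabilityMeasure (combExpMeasure A α)]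
    (hα_pos : ∀ i, 0 < α i) (hdens : ∀ x : ℝ, 0 < x → 0 ≤ combExpDensity A α x) {s : ℂ}
    (hs : 0 ≤ s.re) : ‖∑ i, (A i : ℂ) * α i / (α i + s)‖ ≤ 1 := by
  rw [← integral_exp_combExpMeasure hdens fun i => add_pos_of_pos_of_nonneg (hα_pos i) hs]
  refine (norm_integral_le_of_norm_le_const (C := 1) ?_).trans (by simp)
  filter_upwards [ae_pos_combExpMeasure A α] with x hx
  exact norm_exp_neg_mul_le hs hx.le

open Classical in
/-- The combination of exponentials `∑ k, D k * exp (-(r k * v))` on the half-line `v ≥ 0`,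
continued by `1` to the left. -/
noncomputable def expComb {n : ℕ} (D r : Fin n → ℂ) (v : ℝ) : ℂ :=
  if v < 0 then 1 else ∑ k, D k * Complex.exp (-(r k * v))

theorem measurable_expComb {n : ℕ} (D r : Fin n → ℂ) : Measurable (expComb D r) := by
  refine Measurable.ite measurableSet_Iio measurable_const ?_
  fun_prop

theorem norm_expComb_le {n : ℕ} (D : Fin n → ℂ) {r : Fin n → ℂ} (hr : ∀ k, 0 < (r k).re) (v : ℝ) :
    ‖expComb D r v‖ ≤ 1 + ∑ k, ‖D k‖ := by
  have h0 : 0 ≤ ∑ k, ‖D k‖ := Finset.sum_nonneg fun k _ => norm_nonneg _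
  unfold expComb
  split_ifs with hv
  · simpa using h0
  · refine ((norm_sum_le _ _).trans (Finset.sum_le_sum fun k _ => ?_)).trans
      (le_add_of_nonneg_left zero_le_one)
    rw [norm_mul]
    exact mul_le_of_le_one_right (norm_nonneg _) (norm_exp_neg_mul_le (hr k).le (not_lt.1 hv))

theorem integral_expComb_add {n : ℕ} {A β : Fin n → ℝ} (D : Fin n → ℂ) {r : Fin n → ℂ}
    (hβ_pos : ∀ i, 0 < β i) (hdens : ∀ x : ℝ, 0 < x → 0 ≤ combExpDensity A β x)
    (hr : ∀ k, 0 < (r k).re) {u : ℝ} (hu : 0 ≤ u) :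
    ∫ x, expComb D r (u + x) ∂(combExpMeasure A β) =
      ∑ k, D k * Complex.exp (-(r k * u)) * ∑ i, (A i : ℂ) * β i / (β i + r k) := by
  have hs : ∀ k i, 0 < β i + (r k).re := fun k i => add_pos (hβ_pos i) (hr k)
  rw [integral_combExpMeasure hdens]
  have : ∀ x ∈ Ioi (0 : ℝ), (combExpDensity A β x : ℂ) * expComb D r (u + x) =
      ∑ k, D k * Complex.exp (-(r k * u)) *
        ((combExpDensity A β x : ℂ) * Complex.exp (-(r k * x))) := by
    intro x hx
    rw [expComb, if_neg (by have : 0 < x := hx; linarith), Finset.mul_sum]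
    refine Finset.sum_congr rfl fun k _ => ?_
    push_cast
    rw [mul_add, neg_add, Complex.exp_add]
    ring
  rw [setIntegral_congr_fun measurableSet_Ioi this, integral_finsetSum _ fun k _ =>
    Integrable.const_mul (integrableOn_combExpDensity_mul_exp (hs k) 0) _]
  refine Finset.sum_congr rfl fun k _ => ?_
  rw [integral_const_mul, integral_Ioi_combExpDensity_mul_exp (hs k)]
  simp

/-- A jump `x ≤ u` leaves the surplus non-negative, while `x > u` ruins it and contributes the tail
of the density. The first integral runs over a bounded interval, so `r k` may have real part larger
than `α i`. -/
theorem integral_expComb_sub {n : ℕ} {A α : Fin n → ℝ} (D : Fin n → ℂ) {r : Fin n → ℂ}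
    (hα_pos : ∀ i, 0 < α i) (hdens : ∀ x : ℝ, 0 < x → 0 ≤ combExpDensity A α x)
    (hrα : ∀ i k, (α i : ℂ) ≠ r k) {u : ℝ} (hu : 0 ≤ u) :
    ∫ x, expComb D r (u - x) ∂(combExpMeasure A α) =
      ∑ k, D k * (∑ i, (A i : ℂ) * α i / (α i - r k) *
          (Complex.exp (-(r k * u)) - Complex.exp (-(α i * u)))) +
        ∑ i, (A i : ℂ) * Complex.exp (-(α i * u)) := by
  have hs : ∀ k i, (α i : ℂ) + -r k ≠ 0 := fun k i => by
    rw [← sub_eq_add_neg]; exact sub_ne_zero.2 (hrα i k)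
  rw [integral_combExpMeasure hdens, ← Ioc_union_Ioi_eq_Ioi hu]
  have h1 : ∀ x ∈ Ioc (0 : ℝ) u, (combExpDensity A α x : ℂ) * expComb D r (u - x) =
      ∑ k, D k * Complex.exp (-(r k * u)) *
        ((combExpDensity A α x : ℂ) * Complex.exp (-(-r k * x))) := by
    intro x hx
    rw [expComb, if_neg (by linarith [hx.2]), Finset.mul_sum]
    refine Finset.sum_congr rfl fun k _ => ?_
    push_cast
    rw [show -(r k * ((u : ℂ) - x)) = -(r k * u) + -(-r k * x) by ring, Complex.exp_add]
    ring
  have h2 : ∀ x ∈ Ioi u, (combExpDensity A α x : ℂ) * expComb D r (u - x) =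
      (combExpDensity A α x : ℂ) * Complex.exp (-((0 : ℂ) * x)) := by
    intro x hx
    rw [expComb, if_pos (by have : u < x := hx; linarith)]
    simp
  have hcont : ∀ k, Continuous fun x : ℝ =>
      (combExpDensity A α x : ℂ) * Complex.exp (-(-r k * x)) := fun k => by
    unfold combExpDensity; fun_prop
  have hint : ∀ k, IntegrableOn (fun x : ℝ => D k * Complex.exp (-(r k * u)) *
      ((combExpDensity A α x : ℂ) * Complex.exp (-(-r k * x)))) (Ioc 0 u) := fun k =>
    Integrable.const_mul ((hcont k).integrableOn_Ioc) _
  have hs0 : ∀ i, 0 < α i + (0 : ℂ).re := fun i => by simpa using hα_pos i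
  rw [setIntegral_union (Ioc_disjoint_Ioi le_rfl) measurableSet_Ioi
    ((integrableOn_congr_fun h1 measurableSet_Ioc).2 (integrable_finsetSum _ fun k _ => hint k))
    ((integrableOn_congr_fun h2 measurableSet_Ioi).2 (integrableOn_combExpDensity_mul_exp hs0 u)),
    setIntegral_congr_fun measurableSet_Ioc h1, setIntegral_congr_fun measurableSet_Ioi h2,
    integral_finsetSum _ fun k _ => hint k, integral_Ioi_combExpDensity_mul_exp hs0]
  congr 1
  · refine Finset.sum_congr rfl fun k _ => ?_
    rw [integral_const_mul, integral_Ioc_combExpDensity_mul_exp (hs k) hu, mul_assoc,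
      Finset.mul_sum]
    congr 1
    refine Finset.sum_congr rfl fun i _ => ?_
    have : Complex.exp (-(α i * u : ℂ)) =
        Complex.exp (-(r k * u)) * Complex.exp (-(α i + -r k) * u) := by
      rw [← Complex.exp_add]; congr 1; ring
    rw [this, sub_eq_add_neg (α i : ℂ)]
    ring
  · refine Finset.sum_congr rfl fun i _ => ?_
    have : (α i : ℂ) ≠ 0 := Complex.ofReal_ne_zero.2 (hα_pos i).ne'
    rw [add_zero, mul_div_assoc, div_self this, mul_one, neg_mul]

/-- The integral equation of the ruin probability, for the combination of exponentials. -/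
theorem expComb_eq_integral {n : ℕ} {A α β : Fin n → ℝ} {lam mud t : ℝ} {D r : Fin n → ℂ}
    (hα_pos : ∀ i, 0 < α i) (hβ_pos : ∀ i, 0 < β i)
    (hdensα : ∀ x : ℝ, 0 < x → 0 ≤ combExpDensity A α x)
    (hdensβ : ∀ x : ℝ, 0 < x → 0 ≤ combExpDensity A β x)
    (hr : ∀ k, 0 < (r k).re) (hrα : ∀ i k, (α i : ℂ) ≠ r k)
    (hroot : ∀ k, lundberg A α β lam mud t (r k) = 0)
    (hD : ∀ i, ∑ k, D k / ((α i : ℂ) - r k) = 1 / (α i : ℂ)) {u : ℝ} (hu : 0 ≤ u) :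
    (lam + mud + 1 / t : ℂ) * expComb D r u =
      lam * ∫ x, expComb D r (u + x) ∂(combExpMeasure A β) +
        mud * ∫ x, expComb D r (u - x) ∂(combExpMeasure A α) := by
  rw [integral_expComb_add D hβ_pos hdensβ hr hu, integral_expComb_sub D hα_pos hdensα hrα hu,
    expComb, if_neg hu.not_gt]
  -- The linear system makes the terms in `exp (-α i u)` add up to the negative of the ruin
  -- contribution.
  have h1 : ∑ k, D k * (∑ i, (A i : ℂ) * α i / (α i - r k) *
      (Complex.exp (-(r k * u)) - Complex.exp (-(α i * u)))) =
      ∑ k, D k * Complex.exp (-(r k * u)) * (∑ i, (A i : ℂ) * α i / (α i - r k)) -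
        ∑ i, (A i : ℂ) * Complex.exp (-(α i * u)) := by
    have h2 : ∑ i, (A i : ℂ) * Complex.exp (-(α i * u)) =
        ∑ k, ∑ i, D k * ((A i : ℂ) * α i / (α i - r k) * Complex.exp (-(α i * u))) := by
      rw [Finset.sum_comm]
      refine Finset.sum_congr rfl fun i _ => ?_
      have h3 : ∀ k, D k * ((A i : ℂ) * α i / (α i - r k) * Complex.exp (-(α i * u))) =
          (A i : ℂ) * α i * Complex.exp (-(α i * u)) * (D k / (α i - r k)) := fun k => by ring
      have : (α i : ℂ) ≠ 0 := Complex.ofReal_ne_zero.2 (hα_pos i).ne'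
      rw [Finset.sum_congr rfl fun k _ => h3 k, ← Finset.mul_sum, hD]
      field_simp
    rw [h2, ← Finset.sum_sub_distrib]
    refine Finset.sum_congr rfl fun k _ => ?_
    rw [Finset.mul_sum, Finset.mul_sum, ← Finset.sum_sub_distrib]
    exact Finset.sum_congr rfl fun i _ => by ring
  rw [h1, sub_add_cancel, Finset.mul_sum, Finset.mul_sum, Finset.mul_sum, ← Finset.sum_add_distrib]
  refine Finset.sum_congr rfl fun k _ => ?_
  have h := hroot k
  simp only [lundberg, ← mul_div_assoc] at h
  -- The coefficient of `exp (-r k u)` is a multiple of the Lundberg equation at `r k`.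
  linear_combination (-(D k * Complex.exp (-(r k * u)))) * h

/-! ### Geometric convergence of the approximations. -/

section Contraction

variable {lawW lawB : Measure ℝ} {lam mud q : ℝ} [IsProbabilityMeasure lawW]
  [IsProbabilityMeasure lawB] [IsProbabilityMeasure (expMeasure lam)]
  [IsProbabilityMeasure (expMeasure mud)]

theorem approxRuin_lt_top (hq : 0 ≤ q) (v : ℝ≥0∞) (m : ℕ) (u : ℝ) :
    approxRuin lawW lawB lam mud q v m u < ⊤ :=
  (approxRuin_le_one hq v m u).trans_lt ENNReal.one_lt_top

theorem toReal_approxRuin_le_one (hq : 0 ≤ q) (v : ℝ≥0∞) (m : ℕ) (u : ℝ) :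
    (approxRuin lawW lawB lam mud q v m u).toReal ≤ 1 :=
  ENNReal.toReal_le_of_le_ofReal zero_le_one (by simpa using approxRuin_le_one hq v m u)

theorem norm_toReal_approxRuin_le_one (hq : 0 ≤ q) (v : ℝ≥0∞) (m : ℕ) (u : ℝ) :
    ‖((approxRuin lawW lawB lam mud q v m u).toReal : ℂ)‖ ≤ 1 := by
  rw [Complex.norm_real, Real.norm_of_nonneg ENNReal.toReal_nonneg]
  exact toReal_approxRuin_le_one hq v m u

theorem toReal_lintegral_approxRuin (hq : 0 ≤ q) (v : ℝ≥0∞) (m : ℕ) (ρ : Measure ℝ) {f : ℝ → ℝ}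
    (hf : Measurable f) :
    ((∫⁻ a, approxRuin lawW lawB lam mud q v m (f a) ∂ρ).toReal : ℂ) =
      ∫ a, ((approxRuin lawW lawB lam mud q v m (f a)).toReal : ℂ) ∂ρ := by
  have h := integral_toReal (μ := ρ)
    ((measurable_approxRuin (lawW := lawW) (lawB := lawB) (lam := lam) (mud := mud) (q := q) v m).comp hf).aemeasurable
    (ae_of_all _ fun a => approxRuin_lt_top hq v m (f a))
  exact (congrArg Complex.ofReal h.symm).trans integral_ofReal.symm

theorem toReal_approxRuin_succ (hlam : 0 < lam) (hmud : 0 < mud) (hq : 0 ≤ q) (v : ℝ≥0∞) (m : ℕ)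
    {u : ℝ} (hu : 0 ≤ u) :
    (lam + mud + q : ℂ) * ((approxRuin lawW lawB lam mud q v (m + 1) u).toReal : ℂ) =
      lam * ∫ a, ((approxRuin lawW lawB lam mud q v m (u + a)).toReal : ℂ) ∂lawB +
        mud * ∫ a, ((approxRuin lawW lawB lam mud q v m (u - a)).toReal : ℂ) ∂lawW := by
  have hle : ∀ (ρ : Measure ℝ) [IsProbabilityMeasure ρ] (f : ℝ → ℝ),
      ∫⁻ a, approxRuin lawW lawB lam mud q v m (f a) ∂ρ ≠ ⊤ := fun ρ _ f =>
    ((lintegral_mono fun a => approxRuin_le_one hq v m (f a)).trans_lt (by simp)).ne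
  rw [approxRuin_succ hlam hmud hq v m hu,
    ENNReal.toReal_add (ENNReal.mul_ne_top ENNReal.ofReal_ne_top (hle lawB _))
      (ENNReal.mul_ne_top ENNReal.ofReal_ne_top (hle lawW _)), ENNReal.toReal_mul,
    ENNReal.toReal_mul, ENNReal.toReal_ofReal (by positivity), ENNReal.toReal_ofReal (by positivity)]
  have hσ : (lam + mud + q : ℂ) ≠ 0 := by
    have : 0 < lam + mud + q := by positivity
    exact_mod_cast this.ne'
  push_cast
  rw [toReal_lintegral_approxRuin hq v m lawB (by fun_prop),
    toReal_lintegral_approxRuin hq v m lawW (by fun_prop)]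
  field_simp

/-- Bounded solutions of the integral equation are limits of the approximations. -/
theorem norm_approxRuin_sub_le (hlam : 0 < lam) (hmud : 0 < mud) (hq : 0 < q) (v : ℝ≥0∞) {g : ℝ → ℂ}
    {C : ℝ} (hC : 0 ≤ C) (hgm : Measurable g) (hgC : ∀ u, ‖g u‖ ≤ C) (hg_neg : ∀ u < 0, g u = 1)
    (hg : ∀ u, 0 ≤ u → (lam + mud + q : ℂ) * g u =
      lam * ∫ a, g (u + a) ∂lawB + mud * ∫ a, g (u - a) ∂lawW) (m : ℕ) (u : ℝ) :
    ‖((approxRuin lawW lawB lam mud q v m u).toReal : ℂ) - g u‖ ≤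
      (1 + C) * ((lam + mud) / (lam + mud + q)) ^ m := by
  have hσ : 0 < lam + mud + q := by positivity
  induction m generalizing u with
  | zero =>
    rw [pow_zero, mul_one]
    exact (norm_sub_le _ _).trans (add_le_add (norm_toReal_approxRuin_le_one hq.le v 0 u) (hgC u))
  | succ m ih =>
    set ε := (1 + C) * ((lam + mud) / (lam + mud + q)) ^ m with hε
    rcases lt_or_ge u 0 with hu | hu
    · rw [approxRuin_of_neg v _ hu, hg_neg u hu]
      simp only [ENNReal.toReal_one, Complex.ofReal_one, sub_self, norm_zero]
      positivity
    set φ : ℝ → ℂ := fun u => ((approxRuin lawW lawB lam mud q v m u).toReal : ℂ) with hφ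
    have hφm : Measurable φ := Complex.measurable_ofReal.comp (measurable_approxRuin v m).ennreal_toReal
    have hint : ∀ (ρ : Measure ℝ) [IsProbabilityMeasure ρ] (f : ℝ → ℝ), Measurable f →
        ‖(∫ a, φ (f a) ∂ρ) - ∫ a, g (f a) ∂ρ‖ ≤ ε := by
      intro ρ _ f hf
      have h1 : Integrable (fun a => φ (f a)) ρ :=
        Integrable.of_bound (hφm.comp hf).aestronglyMeasurable 1
          (ae_of_all _ fun a => norm_toReal_approxRuin_le_one hq.le v m (f a))
      have h2 : Integrable (fun a => g (f a)) ρ :=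
        Integrable.of_bound (hgm.comp hf).aestronglyMeasurable C (ae_of_all _ fun a => hgC (f a))
      rw [← integral_sub h1 h2]
      simpa using norm_integral_le_of_norm_le_const (μ := ρ) (ae_of_all _ fun a => ih (f a))
    have hkey : (lam + mud + q : ℂ) *
        (((approxRuin lawW lawB lam mud q v (m + 1) u).toReal : ℂ) - g u) =
        lam * ((∫ a, φ (u + a) ∂lawB) - ∫ a, g (u + a) ∂lawB) +
          mud * ((∫ a, φ (u - a) ∂lawW) - ∫ a, g (u - a) ∂lawW) := by
      rw [mul_sub, toReal_approxRuin_succ hlam hmud hq.le v m hu, hg u hu]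
      ring
    have hnorm := congrArg norm hkey
    rw [norm_mul, show (lam + mud + q : ℂ) = ((lam + mud + q : ℝ) : ℂ) by push_cast; rfl,
      Complex.norm_real, Real.norm_of_nonneg hσ.le] at hnorm
    have hbound : (lam + mud + q) *
        ‖((approxRuin lawW lawB lam mud q v (m + 1) u).toReal : ℂ) - g u‖ ≤ (lam + mud) * ε := by
      rw [hnorm, add_mul]
      refine (norm_add_le _ _).trans (add_le_add ?_ ?_)
      · rw [norm_mul, Complex.norm_real, Real.norm_of_nonneg hlam.le]
        exact mul_le_mul_of_nonneg_left (hint lawB _ (by fun_prop)) hlam.le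
      · rw [norm_mul, Complex.norm_real, Real.norm_of_nonneg hmud.le]
        exact mul_le_mul_of_nonneg_left (hint lawW _ (by fun_prop)) hmud.le
    rw [pow_succ, ← mul_assoc, ← hε, mul_div_assoc', le_div_iff₀ hσ]
    linarith

end Contraction

/-! ### Squeezing the ruin probability. -/

theorem lintegral_measure_le_expMeasure {Ω : Type*} [MeasurableSpace Ω] (P : Measure Ω) [SFinite P]
    {q : ℝ} (hq : 0 < q) {τ : Ω → ℝ≥0∞} (hτ : Measurable τ) :
    ∫⁻ s, P {ω | τ ω ≤ ENNReal.ofReal s} ∂(expMeasure q) = ∫⁻ ω, discount q (τ ω) ∂P := by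
  have := isProbabilityMeasure_expMeasure hq
  have hs : MeasurableSet {p : ℝ × Ω | τ p.2 ≤ ENNReal.ofReal p.1} :=
    measurableSet_le (hτ.comp measurable_snd) (ENNReal.measurable_ofReal.comp measurable_fst)
  refine ((Measure.prod_apply hs).symm.trans (Measure.prod_apply_symm hs)).trans ?_
  exact lintegral_congr fun ω => expMeasure_setOf_le hq (τ ω)

section Ruin

variable {Ω : Type*} [MeasurableSpace Ω] {P : Measure Ω} {lam mud : ℝ}
  {lawW lawB : Measure ℝ} {ξ η W B : ℕ → Ω → ℝ}

/-- Measurability in `s` comes from monotonicity, so measurability of the ruin time in `ω` is not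
needed. -/
theorem ruinProbExp_eq_toReal [IsProbabilityMeasure P] (ξ η W B : ℕ → Ω → ℝ) (u : ℝ) (t : ℝ) :
    ruinProbExp P ξ η W B u t =
      (∫⁻ s, P {ω | ruinTime ξ η W B u ω ≤ ENNReal.ofReal s} ∂(expMeasure (1 / t))).toReal := by
  have hmono : Monotone fun s : ℝ => P {ω | ruinTime ξ η W B u ω ≤ ENNReal.ofReal s} :=
    fun s s' h => measure_mono fun ω hω => le_trans hω (ENNReal.ofReal_le_ofReal h)
  exact integral_toReal hmono.measurable.aemeasurable (ae_of_all _ fun s => measure_lt_top _ _)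

variable [IsProbabilityMeasure lawW] [IsProbabilityMeasure lawB]
  [IsProbabilityMeasure (expMeasure lam)] [IsProbabilityMeasure (expMeasure mud)]

theorem IsPoolModel.ae_goodPath (h : IsPoolModel P lam mud lawW lawB ξ η W B) (hlam : 0 < lam)
    (hmud : 0 < mud) : ∀ᵐ ω ∂P, GoodPath (fun k => ξ k ω) (fun k => η k ω) := by
  have hae : ∀ᵐ z ∂(P.map (poolPath ξ η W B)), GoodPath z.2.2.1 z.2.2.2 := by
    rw [h.map_poolPath]
    exact (Measure.quasiMeasurePreserving_snd.comp Measure.quasiMeasurePreserving_snd).ae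
      (MiningPool.ae_goodPath hlam hmud)
  exact ae_of_ae_map h.measurable_poolPath.aemeasurable hae

theorem IsPoolModel.lintegral_measure_ruinApprox [IsProbabilityMeasure P]
    (h : IsPoolModel P lam mud lawW lawB ξ η W B)
    {q : ℝ} (hq : 0 < q) (v : ℝ≥0∞) (m : ℕ) (u : ℝ) :
    ∫⁻ s, P {ω | ruinApprox v m (u, poolPath ξ η W B ω) ≤ ENNReal.ofReal s} ∂(expMeasure q) =
      approxRuin lawW lawB lam mud q v m u := by
  have hm : Measurable fun z : PathSpace => ruinApprox v m (u, z) :=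
    (measurable_ruinApprox v m).comp measurable_prodMk_left
  refine (lintegral_measure_le_expMeasure P hq (hm.comp h.measurable_poolPath)).trans ?_
  rw [approxRuin, ← h.map_poolPath]
  exact (lintegral_map ((measurable_discount q).comp hm) h.measurable_poolPath).symm

theorem IsPoolModel.ruinProbExp_le [IsProbabilityMeasure P]
    (h : IsPoolModel P lam mud lawW lawB ξ η W B) (hlam : 0 < lam)
    (hmud : 0 < mud) {t : ℝ} (ht : 0 < t) (m : ℕ) (u : ℝ) :
    ruinProbExp P ξ η W B u t ≤ (approxRuin lawW lawB lam mud (1 / t) 0 m u).toReal := by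
  have hq : 0 < 1 / t := by positivity
  rw [ruinProbExp_eq_toReal, ← h.lintegral_measure_ruinApprox hq]
  refine ENNReal.toReal_mono ?_ (lintegral_mono fun s => measure_mono_ae ?_)
  · rw [h.lintegral_measure_ruinApprox hq]
    exact (approxRuin_lt_top hq.le 0 m u).ne
  · filter_upwards [h.ae_goodPath hlam hmud] with ω hω hle
    -- `ruinTime` at `ω` unfolds to `pathRuinTime` of the path. An earlier time means a larger ruin
    -- probability, so `v = 0` bounds from above.
    exact (ruinApprox_zero_le m u _ _ _ _ hω).trans hle

theorem IsPoolModel.le_ruinProbExp [IsProbabilityMeasure P]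
    (h : IsPoolModel P lam mud lawW lawB ξ η W B) (hlam : 0 < lam)
    (hmud : 0 < mud) {t : ℝ} (ht : 0 < t) (m : ℕ) (u : ℝ) :
    (approxRuin lawW lawB lam mud (1 / t) ⊤ m u).toReal ≤ ruinProbExp P ξ η W B u t := by
  have hq : 0 < 1 / t := by positivity
  have := isProbabilityMeasure_expMeasure hq
  rw [ruinProbExp_eq_toReal, ← h.lintegral_measure_ruinApprox hq]
  refine ENNReal.toReal_mono ?_ (lintegral_mono fun s => measure_mono_ae ?_)
  · exact ((lintegral_mono fun s => prob_le_one).trans_lt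
      (by rw [lintegral_one, measure_univ]; exact ENNReal.one_lt_top)).ne
  · filter_upwards [h.ae_goodPath hlam hmud] with ω hω hle
    exact (le_ruinApprox_top m u _ _ _ _ hω).trans hle

theorem IsPoolModel.ruinProbExp_eq [IsProbabilityMeasure P]
    (h : IsPoolModel P lam mud lawW lawB ξ η W B) (hlam : 0 < lam)
    (hmud : 0 < mud) {t : ℝ} (ht : 0 < t) {g : ℝ → ℂ} {C : ℝ} (hC : 0 ≤ C) (hgm : Measurable g)
    (hgC : ∀ u, ‖g u‖ ≤ C) (hg_neg : ∀ u < 0, g u = 1)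
    (hg : ∀ u : ℝ, 0 ≤ u → (lam + mud + 1 / t : ℂ) * g u =
      lam * ∫ a, g (u + a) ∂lawB + mud * ∫ a, g (u - a) ∂lawW) (u : ℝ) :
    (ruinProbExp P ξ η W B u t : ℂ) = g u := by
  have hq : 0 < 1 / t := by positivity
  have hκ : (lam + mud) / (lam + mud + 1 / t) < 1 := by
    rw [div_lt_one (by positivity)]
    linarith
  have hlim : Filter.Tendsto (fun m : ℕ => (1 + C) * ((lam + mud) / (lam + mud + 1 / t)) ^ m)
      Filter.atTop (nhds 0) := by
    simpa using (tendsto_pow_atTop_nhds_zero_of_lt_one (by positivity) hκ).const_mul (1 + C)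
  have hconv : ∀ v, Filter.Tendsto
      (fun m => ((approxRuin lawW lawB lam mud (1 / t) v m u).toReal : ℂ)) Filter.atTop
      (nhds (g u)) := fun v => by
    rw [tendsto_iff_norm_sub_tendsto_zero]
    refine squeeze_zero (fun _ => norm_nonneg _) (fun m => ?_) hlim
    exact norm_approxRuin_sub_le hlam hmud hq v hC hgm hgC hg_neg (by push_cast; exact hg) m u
  have hre : ∀ v, Filter.Tendsto
      (fun m => (approxRuin lawW lawB lam mud (1 / t) v m u).toReal) Filter.atTop
      (nhds (g u).re) := fun v => by
    exact (Complex.continuous_re.tendsto _).comp (hconv v)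
  have heq : (g u).re = ruinProbExp P ξ η W B u t :=
    le_antisymm (le_of_tendsto' (hre ⊤) fun m => h.le_ruinProbExp hlam hmud ht m u)
      (ge_of_tendsto' (hre 0) fun m => h.ruinProbExp_le hlam hmud ht m u)
  rw [← heq]
  -- The squeeze only gives the real part; `g u` is real as a limit of real numbers.
  refine tendsto_nhds_unique ?_ (hconv 0)
  exact (Complex.continuous_ofReal.tendsto _).comp (hre 0)

end Ruin

/-! ### Counting the roots of a polynomial in a half-plane. -/

section RootCount

open Polynomial

open Classical in
/-- The number of roots of a polynomial in a set, counted with multiplicity. -/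
noncomputable def rootCount (p : ℂ[X]) (s : Set ℂ) : ℕ := p.roots.countP (· ∈ s)

theorem card_roots_complex (p : ℂ[X]) : p.roots.card = p.natDegree :=
  (splits_iff_card_roots.1 (IsAlgClosed.splits p))

open Classical in
theorem rootCount_compl (p : ℂ[X]) (s : Set ℂ) :
    rootCount p s + rootCount p sᶜ = p.natDegree := by
  rw [← card_roots_complex, Multiset.card_eq_countP_add_countP (· ∈ s) p.roots, rootCount, rootCount]
  congr 2

theorem rootCount_congr {p : ℂ[X]} {s s' : Set ℂ} (h : ∀ z ∈ p.roots, z ∈ s ↔ z ∈ s') :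
    rootCount p s = rootCount p s' := by
  classical
  exact Multiset.countP_congr rfl fun z hz => by simpa using h z hz

/-- A polynomial with at least `j` roots in `s`, in terms of an enumeration of its roots. -/
theorem le_rootCount_iff {p : ℂ[X]} {N : ℕ} (hp : p.natDegree = N) (hp0 : p ≠ 0) (s : Set ℂ) (j : ℕ) :
    j ≤ rootCount p s ↔ ∃ v : Fin N → ℂ, (∀ x, p.eval x = p.leadingCoeff * ∏ i, (x - v i)) ∧
      j ≤ N ∧ ∀ i : Fin N, (i : ℕ) < j → v i ∈ s := by
  classical
  have hcard := card_roots_complex p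
  constructor
  · intro hj
    obtain ⟨l, hl, hjl, hls⟩ : ∃ l : List ℂ, p.roots = ↑l ∧ j ≤ l.length ∧
        ∀ (i : ℕ) (hi : i < l.length), i < j → l[i] ∈ s := by
      have hj₁ : j ≤ (p.roots.filter (· ∈ s)).toList.length := by
        rw [Multiset.length_toList, ← Multiset.countP_eq_card_filter]
        exact hj
      -- The roots are listed with those in `s` in front.
      refine ⟨(p.roots.filter (· ∈ s)).toList ++ (p.roots.filter (¬ · ∈ s)).toList, ?_, ?_, ?_⟩
      · rw [← Multiset.coe_add, Multiset.coe_toList, Multiset.coe_toList, Multiset.filter_add_not]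
      · rw [List.length_append]
        omega
      · intro i hi hij
        rw [List.getElem_append_left (hij.trans_le hj₁)]
        have h3 := List.getElem_mem (hij.trans_le hj₁)
        rw [Multiset.mem_toList] at h3
        exact (Multiset.mem_filter.1 h3).2
    have hlen : l.length = N := by rw [← hp, ← hcard, hl, Multiset.coe_card]
    subst hlen
    refine ⟨fun i => l[(i : ℕ)], fun x => ?_, hjl, fun i hi => hls i i.2 hi⟩
    conv_lhs => rw [(IsAlgClosed.splits p).eq_prod_roots]
    rw [eval_mul, eval_C, eval_multiset_prod, Multiset.map_map, hl, Multiset.map_coe,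
      Multiset.prod_coe, Fin.prod_univ_fun_getElem l fun z => x - z]
    simp [Function.comp_def]
  · rintro ⟨v, hv, hjN, hvs⟩
    have hpoly : p = C p.leadingCoeff * (Finset.univ.val.map fun i => X - C (v i)).prod := by
      refine Polynomial.funext fun x => ?_
      rw [hv, eval_mul, eval_C, eval_multiset_prod, Multiset.map_map]
      simp [Finset.prod]
    have hroots : p.roots = Finset.univ.val.map v := by
      rw [hpoly, roots_C_mul _ (leadingCoeff_ne_zero.2 hp0)]
      have := roots_multiset_prod_X_sub_C (Finset.univ.val.map v)
      rwa [Multiset.map_map] at this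
    rw [rootCount, hroots, Multiset.countP_map]
    have : (Finset.univ.filter fun i : Fin N => (i : ℕ) < j).card = j := by
      rw [Fin.card_filter_val_lt]
      exact min_eq_right hjN
    conv_lhs => rw [← this]
    refine Finset.card_le_card (t := Finset.univ.filter fun i => v i ∈ s) fun i hi => ?_
    simp only [Finset.mem_filter, Finset.mem_univ, true_and] at hi ⊢
    exact hvs i hi

/-- Far out `R` is at most half of `P` in modulus, so one disc contains the roots for all `c`; this
supplies compactness. -/
theorem norm_root_le {P R : ℂ[X]} {N : ℕ} (hP : P.natDegree = N) (hR : R.degree < N) (hP0 : P ≠ 0) :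
    ∃ M : ℝ, ∀ c : ℝ, c ∈ Icc (0 : ℝ) 1 → ∀ z, (P + C (c : ℂ) * R).eval z = 0 → ‖z‖ ≤ M := by
  have hdeg : R.degree < P.degree := by rwa [degree_eq_natDegree hP0, hP]
  have ho := Polynomial.isLittleO_cobounded_of_degree_lt hdeg
  have h1 : ∀ᶠ z in Bornology.cobounded ℂ, ‖R.eval z‖ ≤ 1 / 2 * ‖P.eval z‖ :=
    ho.bound (by norm_num)
  have h2 : ∀ᶠ z in Bornology.cobounded ℂ, ¬ P.IsRoot z :=
    Bornology.le_cofinite ℂ (eventually_cofinite_not_isRoot hP0)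
  obtain ⟨M, hM⟩ := (Bornology.isBounded_def.2 (by rw [compl_compl]; exact h1.and h2) :
    Bornology.IsBounded {z | ‖R.eval z‖ ≤ 1 / 2 * ‖P.eval z‖ ∧ ¬ P.IsRoot z}ᶜ).exists_norm_le
  refine ⟨M, fun c hc z hz => hM z fun ⟨hz1, hz2⟩ => hz2 ?_⟩
  rw [eval_add, eval_mul, eval_C] at hz
  have h3 : ‖P.eval z‖ ≤ ‖R.eval z‖ := by
    rw [eq_neg_of_add_eq_zero_left hz, norm_neg, norm_mul, Complex.norm_real,
      Real.norm_of_nonneg hc.1]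
    exact mul_le_of_le_one_left (norm_nonneg _) hc.2
  exact norm_le_zero_iff.1 (by linarith)

theorem natDegree_add_C_mul {P R : ℂ[X]} {N : ℕ} (hP : P.natDegree = N) (hR : R.degree < N)
    (hP0 : P ≠ 0) (c : ℂ) : (P + C c * R).natDegree = N ∧
      (P + C c * R).leadingCoeff = P.leadingCoeff := by
  have hdeg : (C c * R).degree < P.degree := by
    rw [degree_eq_natDegree hP0, hP]
    rw [C_mul']
    exact (degree_smul_le c R).trans_lt hR
  exact ⟨by rw [natDegree_add_eq_left_of_degree_lt hdeg, hP], leadingCoeff_add_of_degree_lt' hdeg⟩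

/-- Upper semicontinuity of the number of roots in a closed set, along a segment of polynomials. -/
theorem isClosed_le_rootCount {P R : ℂ[X]} {N : ℕ} (hP : P.natDegree = N) (hR : R.degree < N)
    (hP0 : P ≠ 0) {s : Set ℂ} (hs : IsClosed s) (j : ℕ) :
    IsClosed {c : Icc (0 : ℝ) 1 | j ≤ rootCount (P + C ((c : ℝ) : ℂ) * R) s} := by
  obtain ⟨M, hM⟩ := norm_root_le hP hR hP0
  by_cases hjN : j ≤ N
  swap
  · have : {c : Icc (0 : ℝ) 1 | j ≤ rootCount (P + C ((c : ℝ) : ℂ) * R) s} = ∅ := by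
      refine eq_empty_of_forall_notMem fun c hc => hjN ?_
      refine le_trans hc ?_
      rw [← (natDegree_add_C_mul hP hR hP0 ((c : ℝ) : ℂ)).1, ← rootCount_compl _ s]
      exact Nat.le_add_right _ _
    rw [this]
    exact isClosed_empty
  have hlead : P.leadingCoeff ≠ 0 := leadingCoeff_ne_zero.2 hP0
  -- Pairs of a parameter and an enumeration of the roots whose first `j` entries lie in `s`. `Z` is
  -- compact, and the set in question is its projection.
  set Z : Set (Icc (0 : ℝ) 1 × (Fin N → ℂ)) :=
    {q | (∀ x, (P + C ((q.1 : ℝ) : ℂ) * R).eval x = P.leadingCoeff * ∏ i, (x - q.2 i)) ∧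
      ∀ i : Fin N, (i : ℕ) < j → q.2 i ∈ s} with hZ
  have hZclosed : IsClosed Z := by
    simp only [hZ, ofPred_and, ofPred_forall]
    refine IsClosed.inter (isClosed_iInter fun x => isClosed_eq ?_ ?_)
      (isClosed_iInter fun i => isClosed_iInter fun _ => hs.preimage (by fun_prop))
    · simp only [eval_add, eval_mul, eval_C]
      fun_prop
    · fun_prop
  have hZcompact : IsCompact Z := by
    refine IsCompact.of_isClosed_subset (isCompact_univ.prod
      (isCompact_univ_pi fun _ : Fin N => isCompact_closedBall (0 : ℂ) M)) hZclosed ?_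
    rintro ⟨c, v⟩ hq
    refine ⟨mem_univ _, fun i _ => ?_⟩
    rw [mem_closedBall_zero_iff]
    refine hM c c.2 (v i) ?_
    rw [hq.1 (v i), Finset.prod_eq_zero (Finset.mem_univ i) (sub_self _), mul_zero]
  have himage : {c : Icc (0 : ℝ) 1 | j ≤ rootCount (P + C ((c : ℝ) : ℂ) * R) s} = Prod.fst '' Z := by
    ext c
    obtain ⟨h1, h2⟩ := natDegree_add_C_mul hP hR hP0 ((c : ℝ) : ℂ)
    have h0 : P + C ((c : ℝ) : ℂ) * R ≠ 0 := leadingCoeff_ne_zero.1 (h2 ▸ hlead)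
    rw [mem_ofPred_eq, le_rootCount_iff h1 h0, h2]
    constructor
    · rintro ⟨v, hv, -, hvs⟩
      exact ⟨(c, v), ⟨hv, hvs⟩, rfl⟩
    · rintro ⟨⟨c', v⟩, ⟨hv, hvs⟩, rfl⟩
      exact ⟨v, hv, hjN, hvs⟩
  rw [himage]
  exact (hZcompact.image continuous_fst).isClosed

/-- The number of roots in the right half-plane does not change along a segment of polynomials none
of which has a root on the imaginary axis. -/
theorem rootCount_eq_of_no_imaginary_root {P R : ℂ[X]} {N : ℕ} (hP : P.natDegree = N)
    (hR : R.degree < N) (hP0 : P ≠ 0)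
    (hroot : ∀ c : ℝ, c ∈ Icc (0 : ℝ) 1 → ∀ z : ℂ, z.re = 0 → (P + C (c : ℂ) * R).eval z ≠ 0) :
    rootCount (P + R) {z | 0 < z.re} = rootCount P {z | 0 < z.re} := by
  set k : Icc (0 : ℝ) 1 → ℕ := fun c => rootCount (P + C ((c : ℝ) : ℂ) * R) {z | 0 < z.re} with hk
  have hne : ∀ c : Icc (0 : ℝ) 1, ∀ z ∈ (P + C ((c : ℝ) : ℂ) * R).roots, z.re ≠ 0 :=
    fun c z hz h => hroot c c.2 z h (isRoot_of_mem_roots hz)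
  -- Without imaginary roots, `k` counts roots in a closed half-plane and `N - k` does so in the
  -- opposite one. Both are upper semicontinuous, so `k` is locally constant.
  have hright : ∀ c, k c = rootCount (P + C ((c : ℝ) : ℂ) * R) {z | 0 ≤ z.re} := fun c =>
    rootCount_congr fun z hz => ⟨fun h => le_of_lt (b := z.re) h,
      fun h => lt_of_le_of_ne (b := z.re) h (hne c z hz).symm⟩
  have hleft : ∀ c, k c + rootCount (P + C ((c : ℝ) : ℂ) * R) {z | z.re ≤ 0} = N := fun c => by
    rw [← (natDegree_add_C_mul hP hR hP0 ((c : ℝ) : ℂ)).1, ← rootCount_compl _ {z : ℂ | 0 < z.re}]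
    congr 1
    exact rootCount_congr fun z _ => by simp
  have hcl₁ : ∀ j, IsClosed {c | j ≤ k c} := fun j => by
    simp only [hright]
    exact isClosed_le_rootCount hP hR hP0 (isClosed_le continuous_const Complex.continuous_re) j
  have hcl₂ : ∀ j, IsClosed {c | k c ≤ j} := fun j => by
    have : {c | k c ≤ j} =
        {c : Icc (0 : ℝ) 1 | N - j ≤ rootCount (P + C ((c : ℝ) : ℂ) * R) {z | z.re ≤ 0}} := by
      ext c
      have := hleft c
      simp only [mem_ofPred_eq]
      omega
    rw [this]
    exact isClosed_le_rootCount hP hR hP0 (isClosed_le Complex.continuous_re continuous_const) _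
  have hcont : IsLocallyConstant k := by
    refine IsLocallyConstant.iff_exists_open k |>.2 fun c => ?_
    -- The clause `k c ≠ 0` guards against truncated subtraction.
    refine ⟨{d | k d ≤ k c - 1 ∧ k c ≠ 0}ᶜ ∩ {d | k c + 1 ≤ k d}ᶜ, ?_, ?_, ?_⟩
    · refine IsOpen.inter ?_ (hcl₁ _).isOpen_compl
      by_cases h : k c = 0
      · simp [h]
      · simpa [h] using (hcl₂ (k c - 1)).isOpen_compl
    · simp only [mem_inter_iff, mem_compl_iff, mem_ofPred_eq]
      omega
    · intro d hd
      simp only [mem_inter_iff, mem_compl_iff, mem_ofPred_eq] at hd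
      omega
  have h01 := hcont.apply_eq_of_preconnectedSpace ⟨1, by simp⟩ ⟨0, by simp⟩
  simpa [hk] using h01

end RootCount

/-! ### The linear system for the coefficients. -/

/-- The polynomial of degree less than `n` with value `(1 / α j) * ∏ h, (α j - r h)` at `α j`. -/
noncomputable def ruinPoly {n : ℕ} (α : Fin n → ℝ) (r : Fin n → ℂ) : Polynomial ℂ :=
  Lagrange.interpolate Finset.univ (fun i => (α i : ℂ)) fun j =>
    1 / (α j : ℂ) * ∏ h, ((α j : ℂ) - r h)

theorem ruinCoeff_eq_eval {n : ℕ} (α : Fin n → ℝ) (r : Fin n → ℂ) (k : Fin n) :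
    ruinCoeff α r k = (ruinPoly α r).eval (r k) / ∏ h ∈ Finset.univ.erase k, (r k - r h) := by
  unfold ruinCoeff ruinPoly
  congr 1
  rw [Lagrange.interpolate_apply, Polynomial.eval_finsetSum]
  refine Finset.sum_congr rfl fun j _ => ?_
  rw [Polynomial.eval_mul, Polynomial.eval_C, Lagrange.basis, Polynomial.eval_prod]
  congr 1
  refine Finset.prod_congr rfl fun i _ => ?_
  simp [Lagrange.basisDivisor, div_eq_inv_mul]

/-- Partial fractions: a polynomial of degree less than `n` divided by `∏ h, (z - r h)`. -/
theorem sum_div_sub_eq {n : ℕ} (r : Fin n → ℂ) (hr : Function.Injective r) (H : Polynomial ℂ)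
    (hH : H.degree < n) (z : ℂ) (hz : ∀ k, z ≠ r k) :
    ∑ k, (H.eval (r k) / ∏ h ∈ Finset.univ.erase k, (r k - r h)) / (z - r k) =
      H.eval z / ∏ h, (z - r h) := by
  have hne : ∀ k, z - r k ≠ 0 := fun k => sub_ne_zero.2 (hz k)
  -- `H` is its own interpolant at the nodes `r k`; dividing by `∏ h, (z - r h)` yields the partial
  -- fractions.
  have h1 := Lagrange.eq_interpolate (s := Finset.univ) (v := r) (f := H) hr.injOn (by simpa using hH)
  have h2 : H.eval z = ∑ k, H.eval (r k) * ∏ h ∈ Finset.univ.erase k, (z - r h) / (r k - r h) := by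
    conv_lhs => rw [h1]
    rw [Lagrange.interpolate_apply, Polynomial.eval_finsetSum]
    refine Finset.sum_congr rfl fun j _ => ?_
    rw [Polynomial.eval_mul, Polynomial.eval_C, Lagrange.basis, Polynomial.eval_prod]
    congr 1
    refine Finset.prod_congr rfl fun i _ => ?_
    simp [Lagrange.basisDivisor, div_eq_inv_mul]
  rw [h2, Finset.sum_div]
  refine Finset.sum_congr rfl fun k _ => ?_
  rw [Finset.prod_div_distrib, ← Finset.mul_prod_erase Finset.univ (fun h => z - r h)
    (Finset.mem_univ k)]
  have h3 : ∏ h ∈ Finset.univ.erase k, (z - r h) ≠ 0 := Finset.prod_ne_zero_iff.2 fun h _ => hne h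
  have h4 : ∏ h ∈ Finset.univ.erase k, (r k - r h) ≠ 0 := Finset.prod_ne_zero_iff.2 fun h hh =>
    sub_ne_zero.2 fun e => Finset.ne_of_mem_erase hh (hr e).symm
  have h5 := hne k
  field_simp

/-- Vectors `D` correspond to polynomials `G` of degree less than `n` through `∑ D_k / (z - r_k) =
G(z) / ∏ (z - r_h)`. The system prescribes `G` at the `n` distinct points `α i`, which forces `G =
ruinPoly α r`. -/
theorem linear_system_iff {n : ℕ} (α : Fin n → ℝ) (r : Fin n → ℂ) (hα_inj : Function.Injective α)
    (hr : Function.Injective r) (hrα : ∀ i k, (α i : ℂ) ≠ r k) (D : Fin n → ℂ) :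
    (∀ i, ∑ k, D k / ((α i : ℂ) - r k) = 1 / (α i : ℂ)) ↔ D = ruinCoeff α r := by
  have hinj : Function.Injective fun i => (α i : ℂ) := Complex.ofReal_injective.comp hα_inj
  have hprod : ∀ k, ∏ h ∈ Finset.univ.erase k, (r k - r h) ≠ 0 := fun k =>
    Finset.prod_ne_zero_iff.2 fun h hh =>
      sub_ne_zero.2 fun e => Finset.ne_of_mem_erase hh (hr e).symm
  have hdeg : (ruinPoly α r).degree < n := by
    simpa [ruinPoly] using Lagrange.degree_interpolate_lt (s := Finset.univ)
      (fun j => 1 / (α j : ℂ) * ∏ h, ((α j : ℂ) - r h)) hinj.injOn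
  have heval : ∀ i, (ruinPoly α r).eval (α i : ℂ) = 1 / (α i : ℂ) * ∏ h, ((α i : ℂ) - r h) :=
    fun i => Lagrange.eval_interpolate_at_node _ hinj.injOn (Finset.mem_univ i)
  have hall : ∀ i, ∏ h, ((α i : ℂ) - r h) ≠ 0 := fun i =>
    Finset.prod_ne_zero_iff.2 fun h _ => sub_ne_zero.2 (hrα i h)
  constructor
  · intro hD
    -- the interpolation polynomial whose partial fraction coefficients are `D`
    set v : Fin n → ℂ := fun k => D k * ∏ h ∈ Finset.univ.erase k, (r k - r h) with hv
    set G := Lagrange.interpolate Finset.univ r v with hG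
    have hGdeg : G.degree < n := by
      have h := Lagrange.degree_interpolate_lt (s := Finset.univ) v hr.injOn
      rwa [Finset.card_univ, Fintype.card_fin] at h
    have hGe : ∀ k, G.eval (r k) = v k := fun k =>
      Lagrange.eval_interpolate_at_node _ hr.injOn (Finset.mem_univ k)
    have hDG : ∀ k, D k = G.eval (r k) / ∏ h ∈ Finset.univ.erase k, (r k - r h) := fun k => by
      rw [hGe, hv]; field_simp [hprod k]
    have hGα : ∀ i, G.eval (α i : ℂ) = (ruinPoly α r).eval (α i : ℂ) := by
      intro i
      have h1 := sum_div_sub_eq r hr G hGdeg (α i) (hrα i)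
      simp only [← hDG] at h1
      rw [hD i, eq_div_iff (hall i)] at h1
      rw [heval, h1]
    have hGH : G = ruinPoly α r :=
      Polynomial.eq_of_degrees_lt_of_eval_index_eq Finset.univ hinj.injOn (by simpa using hGdeg)
        (by simpa using hdeg) fun i _ => hGα i
    funext k
    rw [ruinCoeff_eq_eval, hDG k, hGH]
  · rintro rfl i
    simp only [ruinCoeff_eq_eval]
    rw [sum_div_sub_eq r hr _ hdeg (α i) (hrα i), heval, mul_div_assoc, div_self (hall i), mul_one]

/-! ### The roots of the Lundberg equation. -/

section Lundberg

open Polynomial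

/-- The common denominator of the fractions `1 / (α i - z)`. -/
noncomputable def fracDen {n : ℕ} (α : Fin n → ℂ) : ℂ[X] := ∏ i, (C (α i) - X)

/-- The numerator of `∑ i, A i * α i / (α i - z)`. -/
noncomputable def fracNum {n : ℕ} (A α : Fin n → ℂ) : ℂ[X] :=
  ∑ i, C (A i * α i) * ∏ j ∈ Finset.univ.erase i, (C (α j) - X)

theorem natDegree_C_sub_X (a : ℂ) : (C a - X : ℂ[X]).natDegree = 1 := by
  rw [← natDegree_neg, neg_sub, natDegree_X_sub_C]

theorem C_sub_X_ne_zero (a : ℂ) : (C a - X : ℂ[X]) ≠ 0 :=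
  ne_zero_of_natDegree_gt (n := 0) (by rw [natDegree_C_sub_X]; exact zero_lt_one)

theorem fracDen_ne_zero {n : ℕ} (α : Fin n → ℂ) : fracDen α ≠ 0 :=
  Finset.prod_ne_zero_iff.2 fun _ _ => C_sub_X_ne_zero _

theorem natDegree_fracDen {n : ℕ} (α : Fin n → ℂ) : (fracDen α).natDegree = n := by
  rw [fracDen, natDegree_prod _ _ fun _ _ => C_sub_X_ne_zero _]
  simp [natDegree_C_sub_X]

theorem natDegree_fracNum_le {n : ℕ} (A α : Fin n → ℂ) : (fracNum A α).natDegree ≤ n - 1 := by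
  refine natDegree_sum_le_of_forall_le _ _ fun i _ => ?_
  refine (natDegree_C_mul_le _ _).trans ?_
  rw [natDegree_prod _ _ fun _ _ => C_sub_X_ne_zero _]
  simp [natDegree_C_sub_X]

theorem eval_fracDen {n : ℕ} (α : Fin n → ℂ) (z : ℂ) : (fracDen α).eval z = ∏ i, (α i - z) := by
  simp [fracDen, eval_prod]

theorem eval_fracDen_ne_zero {n : ℕ} {α : Fin n → ℂ} {z : ℂ} (hz : ∀ i, z ≠ α i) :
    (fracDen α).eval z ≠ 0 := by
  rw [eval_fracDen]
  exact Finset.prod_ne_zero_iff.2 fun i _ => sub_ne_zero.2 (hz i).symm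

theorem eval_fracNum {n : ℕ} (A : Fin n → ℂ) {α : Fin n → ℂ} {z : ℂ} (hz : ∀ i, z ≠ α i) :
    (fracNum A α).eval z = (fracDen α).eval z * ∑ i, A i * α i / (α i - z) := by
  rw [fracNum, eval_finsetSum, Finset.mul_sum]
  refine Finset.sum_congr rfl fun i _ => ?_
  rw [eval_fracDen, ← Finset.mul_prod_erase Finset.univ (fun j => α j - z) (Finset.mem_univ i),
    eval_mul, eval_C, eval_prod]
  have : α i - z ≠ 0 := sub_ne_zero.2 (hz i).symm
  simp only [eval_sub, eval_C, eval_X]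
  field_simp

/-- Only the `i`-th summand survives at `α i`. Hence clearing denominators creates no spurious root
at a pole. -/
theorem eval_fracNum_self_ne_zero {n : ℕ} {A α : Fin n → ℂ} (hα : Function.Injective α) {i : Fin n}
    (hA : A i ≠ 0) (hαi : α i ≠ 0) : (fracNum A α).eval (α i) ≠ 0 := by
  rw [fracNum, eval_finsetSum, Finset.sum_eq_single i]
  · rw [eval_mul, eval_C, eval_prod]
    refine mul_ne_zero (mul_ne_zero hA hαi) (Finset.prod_ne_zero_iff.2 fun j hj => ?_)
    simp only [eval_sub, eval_C, eval_X]
    exact sub_ne_zero.2 fun e => Finset.ne_of_mem_erase hj (hα e)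
  · intro j _ hji
    rw [eval_mul, eval_prod, Finset.prod_eq_zero (Finset.mem_erase.2 ⟨hji.symm, Finset.mem_univ i⟩),
      mul_zero]
    simp
  · intro h
    exact absurd (Finset.mem_univ i) h

theorem rootCount_mul {p q : ℂ[X]} (h : p * q ≠ 0) (s : Set ℂ) :
    rootCount (p * q) s = rootCount p s + rootCount q s := by
  rw [rootCount, roots_mul h, Multiset.countP_add, rootCount, rootCount]

theorem mem_roots_fracDen {n : ℕ} {α : Fin n → ℂ} {z : ℂ} (hz : z ∈ (fracDen α).roots) :
    ∃ i, z = α i := by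
  by_contra! h
  exact eval_fracDen_ne_zero h (isRoot_of_mem_roots hz)

theorem rootCount_fracDen_of_mem {n : ℕ} {α : Fin n → ℂ} {s : Set ℂ} (h : ∀ i, α i ∈ s) :
    rootCount (fracDen α) s = n := by
  classical
  have h1 : rootCount (fracDen α) s = (fracDen α).roots.card := by
    refine Multiset.countP_eq_card.2 fun z hz => ?_
    obtain ⟨i, rfl⟩ := mem_roots_fracDen hz
    exact h i
  rw [h1, card_roots_complex, natDegree_fracDen]

theorem rootCount_fracDen_of_notMem {n : ℕ} {α : Fin n → ℂ} {s : Set ℂ} (h : ∀ i, α i ∉ s) :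
    rootCount (fracDen α) s = 0 := by
  have h1 := rootCount_compl (fracDen α) s
  rw [rootCount_fracDen_of_mem (s := sᶜ) h, natDegree_fracDen] at h1
  omega

theorem finsum_rootMultiplicity {p : ℂ[X]} {s S : Set ℂ} (hS : ∀ z, z ∈ S ↔ z ∈ p.roots ∧ z ∈ s)
    {f : ℂ → ℕ} (hf : ∀ z ∈ S, f z = p.rootMultiplicity z) :
    S.Finite ∧ ∑ᶠ z ∈ S, f z = rootCount p s := by
  classical
  have hSeq : S = ((p.roots.filter (· ∈ s)).toFinset : Set ℂ) := by
    ext z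
    simp only [hS, Finset.mem_coe, Multiset.mem_toFinset, Multiset.mem_filter]
  refine ⟨hSeq ▸ Finset.finite_toSet _, ?_⟩
  have h1 : rootCount p s = (p.roots.filter (· ∈ s)).card := by
    rw [rootCount, ← Multiset.countP_eq_card_filter]
  rw [h1, ← Multiset.toFinset_sum_count_eq, finsum_mem_congr hSeq fun z hz => hf z (hSeq ▸ hz),
    finsum_mem_coe_finset]
  refine Finset.sum_congr rfl fun z hz => ?_
  rw [Multiset.mem_toFinset, Multiset.mem_filter] at hz
  rw [Multiset.count_filter_of_pos hz.2, count_roots]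

/-- The order of a zero of a quotient of polynomials. -/
theorem analyticOrderNatAt_eq_rootMultiplicity {f : ℂ → ℂ} {p d : ℂ[X]} (hp : p ≠ 0) {z : ℂ}
    (hd : d.eval z ≠ 0) (hf : ∀ᶠ w in nhds z, f w = p.eval w / d.eval w) :
    analyticOrderNatAt f z = p.rootMultiplicity z := by
  obtain ⟨g, hg, hgz⟩ := exists_eq_pow_rootMultiplicity_mul_and_not_dvd p hp z
  have hgz' : g.eval z ≠ 0 := fun h => hgz (dvd_iff_isRoot.2 h)
  have hga : AnalyticAt ℂ (fun w => g.eval w / d.eval w) z :=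
    (AnalyticOnNhd.eval_polynomial g z (mem_univ z)).div
      (AnalyticOnNhd.eval_polynomial d z (mem_univ z)) hd
  have hfg : ∀ᶠ w in nhds z, f w = (w - z) ^ p.rootMultiplicity z • (g.eval w / d.eval w) := by
    filter_upwards [hf] with w hw
    have : p.eval w = (w - z) ^ p.rootMultiplicity z * g.eval w := by
      conv_lhs => rw [hg]
      simp
    rw [hw, this, smul_eq_mul, mul_div_assoc]
  have hfa : AnalyticAt ℂ f z := by
    refine AnalyticAt.congr (f := fun w => (w - z) ^ p.rootMultiplicity z • (g.eval w / d.eval w))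
      ?_ (hfg.mono fun w hw => hw.symm)
    exact ((analyticAt_id.sub analyticAt_const).pow _).smul hga
  have := (hfa.analyticOrderAt_eq_natCast (n := p.rootMultiplicity z)).2
    ⟨_, hga, div_ne_zero hgz' hd, hfg⟩
  rw [analyticOrderNatAt, this]
  rfl

theorem lundberg_eq_neg {n : ℕ} (A α β : Fin n → ℝ) (lam mud t : ℝ) (z : ℂ) :
    lundberg A α β lam mud t z =
      -((lam + mud + 1 / t : ℂ) - (lam * ∑ i, (A i : ℂ) * β i / (β i + z) +
        mud * ∑ i, (A i : ℂ) * α i / (α i - z))) := by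
  simp only [lundberg, mul_div_assoc]
  ring

/-- With multiplicities, the Lundberg equation has `n` solutions with positive real part. -/
theorem lundbergRoots_count {n : ℕ} {A α β : Fin n → ℝ} {lam mud t : ℝ} (hlam : 0 < lam)
    (hmud : 0 < mud) (ht : 0 < t) (hα_pos : ∀ i, 0 < α i) (hβ_pos : ∀ i, 0 < β i)
    (hα_inj : Function.Injective α) (hA_ne : ∀ i, A i ≠ 0)
    (hdensα : ∀ x : ℝ, 0 < x → 0 ≤ combExpDensity A α x)
    (hdensβ : ∀ x : ℝ, 0 < x → 0 ≤ combExpDensity A β x)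
    [IsProbabilityMeasure (combExpMeasure A α)] [IsProbabilityMeasure (combExpMeasure A β)] :
    (lundbergRoots A α β lam mud t).Finite ∧ ∑ᶠ z ∈ lundbergRoots A α β lam mud t,
      analyticOrderNatAt (lundberg A α β lam mud t) z = n := by
  set a : Fin n → ℂ := fun i => α i with ha
  set A' : Fin n → ℂ := fun i => A i
  -- With this sign `A * b / (b - z) = A * β / (β + z)`, so both sums of the Lundberg equation have
  -- the form of `fracNum` over `fracDen`.
  set b : Fin n → ℂ := fun i => -β i with hb
  set σ : ℝ := lam + mud + 1 / t with hσ
  have hq : 0 < 1 / t := by positivity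
  have hσpos : 0 < σ := by positivity
  have hσ0 : (σ : ℂ) ≠ 0 := Complex.ofReal_ne_zero.2 hσpos.ne'
  -- `P + R` is minus the Lundberg function times the common denominator: `P` carries the constant
  -- `σ`, `R` the jump terms, of lower degree.
  set P : ℂ[X] := C (σ : ℂ) * (fracDen a * fracDen b) with hP
  set R : ℂ[X] := -(C (lam : ℂ) * (fracNum A' b * fracDen a) + C (mud : ℂ) *
    (fracNum A' a * fracDen b)) with hR
  have hden : fracDen a * fracDen b ≠ 0 := mul_ne_zero (fracDen_ne_zero a) (fracDen_ne_zero b)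
  have hP0 : P ≠ 0 := mul_ne_zero (C_ne_zero.2 hσ0) hden
  have hPdeg : P.natDegree = n + n := by
    rw [hP, natDegree_C_mul hσ0, natDegree_mul (fracDen_ne_zero a) (fracDen_ne_zero b),
      natDegree_fracDen, natDegree_fracDen]
  have hterm : ∀ (c : ℂ) (x y : Fin n → ℂ),
      (C c * (fracNum A' x * fracDen y)).natDegree ≤ (n - 1) + n := fun c x y =>
    (natDegree_C_mul_le _ _).trans (natDegree_mul_le.trans
      (add_le_add (natDegree_fracNum_le _ _) (natDegree_fracDen y).le))
  have hRdeg : n ≠ 0 → R.degree < ((n + n : ℕ) : WithBot ℕ) := fun hn => by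
    have h1 : R.natDegree ≤ (n - 1) + n := by
      rw [hR, natDegree_neg]
      exact natDegree_add_le_of_degree_le (hterm _ _ _) (hterm _ _ _)
    refine (degree_le_of_natDegree_le h1).trans_lt ?_
    exact_mod_cast (by omega : (n - 1) + n < n + n)
  have heval : ∀ (c z : ℂ), (∀ i, z ≠ a i) → (∀ i, z ≠ b i) → (P + C c * R).eval z =
      (fracDen a * fracDen b).eval z * (σ - c * (lam * ∑ i, (A i : ℂ) * β i / (β i + z) +
        mud * ∑ i, (A i : ℂ) * α i / (α i - z))) := by
    intro c z hza hzb
    have h1 : ∑ i, A' i * b i / (b i - z) = ∑ i, (A i : ℂ) * β i / (β i + z) := by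
      refine Finset.sum_congr rfl fun i _ => ?_
      rw [hb, ← neg_div_neg_eq]
      congr 1 <;> ring
    simp only [hP, hR, eval_add, eval_mul, eval_C, eval_neg, eval_fracNum A' hza,
      eval_fracNum A' hzb, h1]
    ring
  have hright : ∀ z : ℂ, 0 ≤ z.re → ∀ i, z ≠ b i := by
    rintro z hz i rfl
    have := hβ_pos i
    simp only [hb, Complex.neg_re, Complex.ofReal_re] at hz
    linarith
  have hleft : ∀ z : ℂ, z.re ≤ 0 → ∀ i, z ≠ a i := by
    rintro z hz i rfl
    have := hα_pos i
    simp only [ha, Complex.ofReal_re] at hz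
    linarith
  -- For imaginary `z` both Laplace transforms have modulus at most `1`, so a root would give `σ ≤
  -- lam + mud`, contrary to `1 / t > 0`.
  have himag : ∀ c : ℝ, c ∈ Icc (0 : ℝ) 1 → ∀ z : ℂ, z.re = 0 → (P + C (c : ℂ) * R).eval z ≠ 0 := by
    intro c hc z hz
    rw [heval c z (hleft z hz.le) (hright z hz.ge), eval_mul]
    refine mul_ne_zero (mul_ne_zero (eval_fracDen_ne_zero (hleft z hz.le))
      (eval_fracDen_ne_zero (hright z hz.ge))) fun h => ?_
    have h1 := norm_laplace_le_one (s := z) hβ_pos hdensβ hz.ge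
    have h2 := norm_laplace_le_one (s := -z) hα_pos hdensα (by simp [hz])
    simp only [← sub_eq_add_neg] at h2
    have h3 : σ ≤ lam + mud := by
      calc σ = ‖(σ : ℂ)‖ := by rw [Complex.norm_real, Real.norm_of_nonneg hσpos.le]
        _ = ‖(c : ℂ) * (lam * ∑ i, (A i : ℂ) * β i / (β i + z) +
            mud * ∑ i, (A i : ℂ) * α i / (α i - z))‖ := by rw [sub_eq_zero.1 h]
        _ ≤ 1 * (lam * 1 + mud * 1) := by
            rw [norm_mul, Complex.norm_real, Real.norm_of_nonneg hc.1]
            refine mul_le_mul hc.2 ((norm_add_le _ _).trans (add_le_add ?_ ?_)) (norm_nonneg _)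
              zero_le_one
            · rw [norm_mul, Complex.norm_real, Real.norm_of_nonneg hlam.le]
              exact mul_le_mul_of_nonneg_left h1 hlam.le
            · rw [norm_mul, Complex.norm_real, Real.norm_of_nonneg hmud.le]
              exact mul_le_mul_of_nonneg_left h2 hmud.le
        _ = lam + mud := by ring
    linarith
  have hcount : rootCount (P + R) {z | 0 < z.re} = n := by
    rcases Nat.eq_zero_or_pos n with hn | hn
    · subst hn
      have hR0 : R = 0 := by simp [hR, fracNum]
      have h1 := rootCount_compl (P + R) {z | 0 < z.re}
      rw [hR0, add_zero, hPdeg] at h1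
      rw [hR0, add_zero]
      omega
    -- At `c = 0` the roots are the `α i`, all to the right of the axis, and the `-β i`, all to the
    -- left.
    rw [rootCount_eq_of_no_imaginary_root hPdeg (hRdeg hn.ne') hP0 himag, rootCount, hP,
      roots_C_mul _ hσ0, ← rootCount, rootCount_mul hden,
      rootCount_fracDen_of_mem fun i => by simpa [ha] using hα_pos i,
      rootCount_fracDen_of_notMem fun i => by simpa [hb] using (hβ_pos i).le, add_zero]
  have hPR0 : P + R ≠ 0 := fun h => by
    have := himag 1 (by simp) 0 rfl
    rw [Complex.ofReal_one, C_1, one_mul, h] at this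
    simp at this
  have hlund : ∀ z : ℂ, (∀ i, z ≠ a i) → (∀ i, z ≠ b i) →
      lundberg A α β lam mud t z = (P + R).eval z / (-(fracDen a * fracDen b)).eval z := by
    intro z hza hzb
    have h1 := heval 1 z hza hzb
    rw [C_1, one_mul, one_mul] at h1
    have h2 : (fracDen a * fracDen b).eval z ≠ 0 := by
      rw [eval_mul]
      exact mul_ne_zero (eval_fracDen_ne_zero hza) (eval_fracDen_ne_zero hzb)
    rw [h1, lundberg_eq_neg, eval_neg, div_neg, mul_div_cancel_left₀ _ h2, hσ]
    push_cast
    rfl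
  have hpole : ∀ i, (P + R).eval (a i) ≠ 0 := by
    intro i
    have h1 : (fracDen a).eval (a i) = 0 := by
      rw [eval_fracDen, Finset.prod_eq_zero (Finset.mem_univ i) (sub_self _)]
    have h2 : (P + R).eval (a i) = -(mud * ((fracNum A' a).eval (a i) * (fracDen b).eval (a i))) := by
      simp [hP, hR, h1]
    rw [h2]
    refine neg_ne_zero.2 (mul_ne_zero (Complex.ofReal_ne_zero.2 hmud.ne') (mul_ne_zero ?_ ?_))
    · exact eval_fracNum_self_ne_zero (Complex.ofReal_injective.comp hα_inj)
        (Complex.ofReal_ne_zero.2 (hA_ne i)) (Complex.ofReal_ne_zero.2 (hα_pos i).ne')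
    · exact eval_fracDen_ne_zero (hright _ (hα_pos i).le)
  have hroots : ∀ z, z ∈ lundbergRoots A α β lam mud t ↔
      z ∈ (P + R).roots ∧ z ∈ {z : ℂ | 0 < z.re} := by
    intro z
    rw [mem_roots hPR0, IsRoot.def]
    constructor
    · rintro ⟨h1, h2, h3⟩
      refine ⟨?_, h1⟩
      rw [hlund z h2 (hright z h1.le), div_eq_zero_iff] at h3
      refine h3.resolve_right ?_
      rw [eval_neg, eval_mul]
      exact neg_ne_zero.2 (mul_ne_zero (eval_fracDen_ne_zero h2)
        (eval_fracDen_ne_zero (hright z h1.le)))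
    · rintro ⟨h1, h2⟩
      have h3 : ∀ i, z ≠ a i := by
        rintro i rfl
        exact hpole i h1
      refine ⟨h2, h3, ?_⟩
      rw [hlund z h3 (hright z (le_of_lt (b := z.re) h2)), h1, zero_div]
  have hmain := finsum_rootMultiplicity (f := analyticOrderNatAt (lundberg A α β lam mud t)) hroots
  rw [hcount] at hmain
  refine hmain fun z hz => ?_
  obtain ⟨h1, h2, -⟩ := hz
  refine analyticOrderNatAt_eq_rootMultiplicity hPR0 (d := -(fracDen a * fracDen b)) ?_ ?_
  · rw [eval_neg, eval_mul]
    exact neg_ne_zero.2 (mul_ne_zero (eval_fracDen_ne_zero h2)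
      (eval_fracDen_ne_zero (hright z h1.le)))
  · have hne : ∀ᶠ w in nhds z, ∀ i, w ≠ a i :=
      Filter.eventually_all.2 fun i => isOpen_ne.mem_nhds (h2 i)
    have hne' : ∀ᶠ w in nhds z, ∀ i, w ≠ b i :=
      Filter.eventually_all.2 fun i => isOpen_ne.mem_nhds (hright z h1.le i)
    filter_upwards [hne, hne'] with w hw hw'
    exact hlund w hw hw'

end Lundberg

end MiningPool

/-! ### The theorem. -/

theorem theorem4p3 {Ω : Type*} [MeasurableSpace Ω] (P : Measure Ω) [IsProbabilityMeasure P]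
    {n : ℕ} (A α β : Fin n → ℝ) (a lam mud t : ℝ)
    (hlam : 0 < lam) (hmud : 0 < mud) (ht : 0 < t) (ha : 1 < a)
    (hα_pos : ∀ i, 0 < α i) (hα_mono : StrictMono α) (hβ : ∀ i, β i = α i / a)
    (hA_ne : ∀ i, A i ≠ 0) (hA_sum : ∑ i, A i = 1)
    (hdens : ∀ x : ℝ, 0 < x → 0 ≤ MiningPool.combExpDensity A α x)
    (ξ η W B : ℕ → Ω → ℝ)
    (hmodel : MiningPool.IsPoolModel P lam mud (MiningPool.combExpMeasure A α)
      (MiningPool.combExpMeasure A β) ξ η W B) :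
    -- with multiplicities, the Lundberg equation has `n` solutions with positive real part
    ((MiningPool.lundbergRoots A α β lam mud t).Finite ∧
      ∑ᶠ z ∈ MiningPool.lundbergRoots A α β lam mud t,
        analyticOrderNatAt (MiningPool.lundberg A α β lam mud t) z = n) ∧
    -- if these are distinct, the ruin probability is the stated combination of exponentials
    ∀ r : Fin n → ℂ, Function.Injective r →
      Set.range r = MiningPool.lundbergRoots A α β lam mud t →
      (∀ u : ℝ, 0 ≤ u →
        (MiningPool.ruinProbExp P ξ η W B u t : ℂ) =
          ∑ k, MiningPool.ruinCoeff α r k * Complex.exp (-(r k * u))) ∧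
      ∀ D : Fin n → ℂ,
        (∀ i, ∑ k, D k / ((α i : ℂ) - r k) = 1 / (α i : ℂ)) ↔ D = MiningPool.ruinCoeff α r := by
  have hβ_pos : ∀ i, 0 < β i := fun i => by
    rw [hβ]
    exact div_pos (hα_pos i) (one_pos.trans ha)
  have hdensβ : ∀ x : ℝ, 0 < x → 0 ≤ MiningPool.combExpDensity A β x := fun x hx => by
    rw [MiningPool.combExpDensity_div hβ]
    exact div_nonneg (hdens _ (div_pos hx (one_pos.trans ha))) (one_pos.trans ha).le
  -- The total mass is one because this is the law of `W 0`.
  have : IsProbabilityMeasure (MiningPool.combExpMeasure A α) := by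
    rw [← hmodel.law_W 0]
    exact Measure.isProbabilityMeasure_map (hmodel.measurable_W 0).aemeasurable
  have : IsProbabilityMeasure (MiningPool.combExpMeasure A β) := by
    rw [← hmodel.law_B 0]
    exact Measure.isProbabilityMeasure_map (hmodel.measurable_B 0).aemeasurable
  have := isProbabilityMeasure_expMeasure hlam
  have := isProbabilityMeasure_expMeasure hmud
  refine ⟨MiningPool.lundbergRoots_count hlam hmud ht hα_pos hβ_pos hα_mono.injective hA_ne hdens
    hdensβ, fun r hr hrange => ?_⟩
  have hroot : ∀ k, r k ∈ MiningPool.lundbergRoots A α β lam mud t := fun k =>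
    hrange ▸ mem_range_self k
  have hrα : ∀ i k, (α i : ℂ) ≠ r k := fun i k => ((hroot k).2.1 i).symm
  have hsys := MiningPool.linear_system_iff α r hα_mono.injective hr hrα
  refine ⟨fun u hu => ?_, hsys⟩
  have h := hmodel.ruinProbExp_eq hlam hmud ht
    (add_nonneg zero_le_one (Finset.sum_nonneg fun k _ => norm_nonneg (MiningPool.ruinCoeff α r k)))
    (MiningPool.measurable_expComb (MiningPool.ruinCoeff α r) r)
    (MiningPool.norm_expComb_le _ fun k => (hroot k).1)
    (fun v hv => if_pos hv)
    (fun v hv => MiningPool.expComb_eq_integral hα_pos hβ_pos hdens hdensβ (fun k => (hroot k).1) hrα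
      (fun k => (hroot k).2.2) ((hsys _).2 rfl) hv) u
  rw [h, MiningPool.expComb, if_neg hu.not_gt]
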